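/- **Model.** There are $M\ge 1$ UAVs and $N$ channels; UAV $i$ has a fixed non-empty set of selected channels, $C_{in}=1$ if it has selected channel $n$ and $C_{in}=0$ otherwise. Available powers are $P_1, P_1+\Delta P,\dots$ ($np\ge 1$ levels) and available altitudes are $h_1, h_1+\Delta h,\dots,h_{nh}$ ($nh\ge 2$ levels), with $P_1,\Delta P,h_1,\Delta h>0$. A strategy $s_i$ of UAV $i$ consists of a power level $P_{in}$ for each selected channel ($P_{in}=0$ for the others) and an altitude $h_i$. With noise $Ns_n$, put $\sigma_{ip}(s_{-i})_{(n)}=C_{in}\big(\sum_{j\ne i}P_{jn}+Ns_n\big)$, $D_i=\pi(h_i\tan\theta)^2$, $\bar D_i=D_i-\kappa\sum_{j\neq i}D_j$ and $\tilde D_i=\pi(h_i\tan\theta)^{2\beta}$, where $0<\theta<\pi/2$ and the real number $\beta=\beta(h_i)$ may depend on the altitude. The utility of UAV $i$ is $$U_i(s)=\frac{AE}{\sum_n P_{in}}+B\Big\{\mu\sum_n C_{in}\big[P_{in}-\gamma\,\sigma_{ip}(s_{-i})_{(n)}\big]-\alpha\bar D_i\Big\}+\frac{C\tilde D_i}{D},$$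 with $A,B,C,E,\mu,\alpha,\gamma,\kappa\ge 0$ and $D>0$. The constrained strategy set $C_i(s_i)$ consists of the strategies in which the power in each selected channel and the altitude each are kept or moved to an adjacent level. **Algorithm SPBLLA** (parameters $\tau>0$ and $m$; $\epsilon=e^{-1/\tau}$, $\omega=\epsilon^m$). The state is $[s(t-1),s(t),x(t)]$, $x(t)\in\{0,1\}^M$. All UAVs act simultaneously and independently. If $x_i(t)=0$, then with probability $\omega$ UAV $i$ draws $s_i(t+1)$ uniformly from $C_i(s_i(t))$ and sets $x_i(t+1)=1$; otherwise $s_i(t+1)=s_i(t)$ and $x_i(t+1)=0$. If $x_i(t)=1$, then $s_i(t+1)$ is $s_i(t-1)$ or $s_i(t)$, with probabilities proportional to $e^{U_i(s(t-1))/\tau}$ and $e^{U_i(s(t))/\tau}$, and $x_i(t+1)=0$. The state space consists of the triples $[s,s',x]$ with $s'_i\in C_i(s_i)$ for all $i$. **Definition.** Let $\phi$ be an exact potential of the game, i.e. $U_i(s_i',s_{-i})-U_i(s)=\phi(s_i',s_{-i})-\phi(s)$ for all $i$, $s$, $s_i'$. We say that *SPBLLA converges* if: it is a regular perturbed Markov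 process in $\epsilon\in(0,1)$ (irreducible and aperiodic for every $\epsilon$; the transition matrix has a limit as $\epsilon\to0^+$ that is again a transition matrix; and for every possible transition $z\to z'$ there is a resistance $R\ge0$ with $0<\lim_{\epsilon\to 0^+}P_\epsilon(z,z')/\epsilon^{R}<\infty$); its stationary distribution is unique for every $\epsilon$ and has a limit as $\epsilon\to0^+$; a state has a positive limit probability (is stochastically stable) if and only if it is $[s,s,\mathbf 0]$ with $s$ a global maximizer of $\phi$; and all global maximizers of $\phi$ are pure strategy Nash equilibria. **Theorem.** For $d\ge0$ put $$\begin{aligned}\Delta_i(d)={}&AE\,\frac{\Delta P}{(\sum_n C_{in})\,P_1(P_1+\Delta P)}+B\mu\Big(\sum_n C_{in}\Big)\Delta P+B\mu\gamma\,\Delta P\sum_n\sum_{j\ne i}C_{jn}C_{in}\\&+B\alpha\pi\tan^2\theta\,(2h_{nh}\Delta h-\Delta h^2)+B\alpha\kappa(M-1)\pi\tan^2\theta\,(2h_{nh}\Delta h-\Delta h^2)+\frac CD\,\pi\, d .\end{aligned}$$ The game has an exact potential, and for every exact potential $\phi$ of it the following hold. 1. Let $\Delta_i=\Delta_i(d)$,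 where $d$ is the maximum of $|(h\tan\theta)^{2\beta(h)}-(h'\tan\theta)^{2\beta(h')}|$ over pairs of equal or adjacent altitude levels $h,h'$. Then $|U_i(s')-U_i(s)|\le\Delta_i$ for every $i$ whenever $s'_j\in C_j(s_j)$ for all $j$ (one iteration). If $m>2\Delta_i$ for all $i$, then SPBLLA converges. 2. Suppose that $\beta\ge 0$ is constant, and let $\Delta_i=\Delta_i(d)$ with $d=\tan^{2\beta}\theta\,\big[h_{nh}^{2\beta}-(h_{nh}-\Delta h)^{2\beta}\big]$. If $m>2\Delta_i$ for all $i$, then SPBLLA converges. If $\beta\ge\tfrac12$, then moreover $|U_i(s')-U_i(s)|\le\Delta_i$ for every $i$ whenever $s'_j\in C_j(s_j)$ for all $j$. -/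

import Mathlib

open Filter Topology

noncomputable section

/-! ### Strategic games -/

/-- `φ` is an exact potential of the game with payoff functions `U`: every unilateral change of
strategy changes the payoff of the deviating player and `φ` by the same amount. -/
def IsPotential {ι : Type*} [DecidableEq ι] {S : ι → Type*}
    (U : ι → (∀ i, S i) → ℝ) (φ : (∀ i, S i) → ℝ) : Prop :=
  ∀ (i : ι) (s : ∀ i, S i) (a : S i),
    U i (Function.update s i a) - U i s = φ (Function.update s i a) - φ s

/-- Pure strategy Nash equilibrium. -/
def IsPSNE {ι : Type*} [DecidableEq ι] {S : ι → Type*}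
    (U : ι → (∀ i, S i) → ℝ) (s : ∀ i, S i) : Prop :=
  ∀ (i : ι) (a : S i), U i (Function.update s i a) ≤ U i s

/-- `s` is a global maximizer of `φ`. -/
def IsMaximizer {α : Type*} (φ : α → ℝ) (s : α) : Prop := ∀ t, φ t ≤ φ s

/-! ### Regular perturbed Markov processes and stochastic stability -/

/-- The period of every state is `1`. -/
def IsAperiodic {Z : Type*} [Fintype Z] [DecidableEq Z] (P : Matrix Z Z ℝ) : Prop :=
  ∀ (z : Z) (d : ℕ), (∀ k : ℕ, 0 < k → 0 < (P ^ k) z z → d ∣ k) → d = 1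

/-- `ν` is a stationary probability distribution of the transition matrix `P`. -/
def IsStationaryDistribution {Z : Type*} [Fintype Z] (P : Matrix Z Z ℝ) (ν : Z → ℝ) : Prop :=
  (∀ z, 0 ≤ ν z) ∧ ∑ z, ν z = 1 ∧ Matrix.vecMul ν P = ν

/-- A family of Markov processes on a finite state space, with noise `ε ∈ (0, 1)`, is a regular
perturbed Markov process. -/
structure IsRegularPerturbed {Z : Type*} [Fintype Z] [DecidableEq Z]
    (P : ℝ → Matrix Z Z ℝ) : Prop where
  /-- every `P ε` is a transition matrix -/
  stochastic : ∀ ε ∈ Set.Ioo (0 : ℝ) 1, P ε ∈ Matrix.rowStochastic ℝ Z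
  /-- every `P ε` is irreducible -/
  irreducible : ∀ ε ∈ Set.Ioo (0 : ℝ) 1, (P ε).IsIrreducible
  /-- every `P ε` is aperiodic -/
  aperiodic : ∀ ε ∈ Set.Ioo (0 : ℝ) 1, IsAperiodic (P ε)
  /-- `P ε` converges to the transition matrix of an unperturbed process -/
  limit : ∃ P₀ ∈ Matrix.rowStochastic ℝ Z, Tendsto P (𝓝[>] 0) (𝓝 P₀)
  /-- every possible transition has a resistance `R ≥ 0` -/
  resistance : ∀ z z' : Z, (∃ ε ∈ Set.Ioo (0 : ℝ) 1, 0 < P ε z z') →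
    ∃ R : ℝ, 0 ≤ R ∧ ∃ c : ℝ, 0 < c ∧ Tendsto (fun ε => P ε z z' / ε ^ R) (𝓝[>] 0) (𝓝 c)

/-- The state `z` is stochastically stable: its stationary probability has a positive limit
as the noise vanishes. -/
def IsStochasticallyStable {Z : Type*} [Fintype Z] (P : ℝ → Matrix Z Z ℝ) (z : Z) : Prop :=
  ∃ ν : ℝ → Z → ℝ, (∀ ε ∈ Set.Ioo (0 : ℝ) 1, IsStationaryDistribution (P ε) (ν ε)) ∧
    ∃ l : ℝ, 0 < l ∧ Tendsto (fun ε => ν ε z) (𝓝[>] 0) (𝓝 l)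

/-! ### The UAV ad-hoc network game -/

/-- Parameters of a UAV ad-hoc network. -/
structure UAVNetwork where
  /-- number of UAVs -/
  M : ℕ
  /-- number of channels -/
  N : ℕ
  /-- number of power levels -/
  np : ℕ
  /-- number of altitude levels -/
  nh : ℕ
  M_pos : 0 < M
  np_pos : 0 < np
  two_le_nh : 2 ≤ nh
  /-- the (fixed) set of channels selected by each UAV -/
  sel : Fin M → Finset (Fin N)
  sel_nonempty : ∀ i, (sel i).Nonempty
  /-- lowest power level -/
  P₁ : ℝ
  /-- gap between adjacent power levels -/
  ΔP : ℝ
  /-- lowest altitude level -/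
  h₁ : ℝ
  /-- gap between adjacent altitude levels -/
  Δh : ℝ
  /-- intrinsic noise in each channel -/
  noise : Fin N → ℝ
  /-- energy (battery capacity) -/
  E : ℝ
  /-- size of the mission area -/
  D : ℝ
  /-- field angle -/
  θ : ℝ
  /-- air turbulence index at each altitude level -/
  β : Fin nh → ℝ
  /-- balance index of the energy utility -/
  A : ℝ
  /-- balance index of the SNR utility -/
  B : ℝ
  /-- balance index of the coverage utility -/
  C : ℝ
  /-- SNR index -/
  μ : ℝ
  /-- balance index between SNR and coverage size -/
  α : ℝ
  /-- SNR balance index -/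
  γ : ℝ
  /-- overlap index -/
  κ : ℝ
  P₁_pos : 0 < P₁
  ΔP_pos : 0 < ΔP
  h₁_pos : 0 < h₁
  Δh_pos : 0 < Δh
  D_pos : 0 < D
  θ_pos : 0 < θ
  θ_lt : θ < Real.pi / 2
  E_nonneg : 0 ≤ E
  A_nonneg : 0 ≤ A
  B_nonneg : 0 ≤ B
  C_nonneg : 0 ≤ C
  μ_nonneg : 0 ≤ μ
  α_nonneg : 0 ≤ α
  γ_nonneg : 0 ≤ γ
  κ_nonneg : 0 ≤ κ

namespace UAVNetwork

/-- A strategy of UAV `i`: a power level in each selected channel, and an altitude level. -/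
abbrev Strategy (G : UAVNetwork) (i : Fin G.M) : Type :=
  ({n : Fin G.N // n ∈ G.sel i} → Fin G.np) × Fin G.nh

/-- Strategy profiles. -/
abbrev Profile (G : UAVNetwork) : Type := ∀ i : Fin G.M, G.Strategy i

/-- `C_{in}`: `1` if UAV `i` has selected channel `n`, otherwise `0`. -/
def chan (G : UAVNetwork) (i : Fin G.M) (n : Fin G.N) : ℝ := if n ∈ G.sel i then 1 else 0

/-- The `k`-th power level (counted from `0`). -/
def powerLevel (G : UAVNetwork) (k : Fin G.np) : ℝ := G.P₁ + (k : ℕ) * G.ΔP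

/-- The `k`-th altitude level (counted from `0`). -/
def altLevel (G : UAVNetwork) (k : Fin G.nh) : ℝ := G.h₁ + (k : ℕ) * G.Δh

/-- The highest altitude level `h_{nh}`. -/
def hTop (G : UAVNetwork) : ℝ := G.h₁ + ((G.nh : ℝ) - 1) * G.Δh

/-- `P_{in}`: the power of UAV `i` in channel `n`. -/
def power (G : UAVNetwork) (s : G.Profile) (i : Fin G.M) (n : Fin G.N) : ℝ :=
  if hn : n ∈ G.sel i then G.powerLevel ((s i).1 ⟨n, hn⟩) else 0

/-- `σ`: the sum of all powers and the noise, in channel `n`. -/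
def sigma (G : UAVNetwork) (s : G.Profile) (n : Fin G.N) : ℝ :=
  ∑ j, G.power s j n + G.noise n

/-- `σ_{ip}(s_{-i}) = (σ - P_i) ⊗ C_i`: the power interaction term, in channel `n`. -/
def interaction (G : UAVNetwork) (s : G.Profile) (i : Fin G.M) (n : Fin G.N) : ℝ :=
  (G.sigma s n - G.power s i n) * G.chan i n

/-- `D_i`: the area covered by UAV `i`. -/
def coverage (G : UAVNetwork) (s : G.Profile) (i : Fin G.M) : ℝ :=
  Real.pi * (G.altLevel (s i).2 * Real.tan G.θ) ^ 2

/-- `D̄_i`: the coverage corrected for overlaps. -/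
def trueCoverage (G : UAVNetwork) (s : G.Profile) (i : Fin G.M) : ℝ :=
  G.coverage s i - G.κ * ∑ j ∈ Finset.univ.erase i, G.coverage s j

/-- `D̃`: the utility of the area covered at the altitude level `k`, subject to turbulence. -/
def coverageUtility (G : UAVNetwork) (k : Fin G.nh) : ℝ :=
  Real.pi * (G.altLevel k * Real.tan G.θ) ^ (2 * G.β k)

/-- The utility function `U_i = A U_E + B U_SNR + C U_D` of UAV `i`. -/
def utility (G : UAVNetwork) (i : Fin G.M) (s : G.Profile) : ℝ :=
  G.A * (G.E / ∑ n, G.power s i n)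
    + G.B * (G.μ * ∑ n, (G.power s i n - G.γ * G.interaction s i n) * G.chan i n
        - G.α * G.trueCoverage s i)
    + G.C * (G.coverageUtility (s i).2 / G.D)

/-- Two levels that are equal or adjacent. -/
def NearLevel {n : ℕ} (k l : Fin n) : Prop := (k : ℕ) ≤ l + 1 ∧ (l : ℕ) ≤ k + 1

instance {n : ℕ} (k l : Fin n) : Decidable (NearLevel k l) :=
  inferInstanceAs (Decidable (_ ∧ _))

/-- `C_i(a)`: the constrained strategy set of UAV `i` when its current strategy is `a`. In one
move the power in each selected channel and the altitude may each be kept or be changed to an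
adjacent level. -/
def moves (G : UAVNetwork) (i : Fin G.M) (a : G.Strategy i) : Finset (G.Strategy i) :=
  Finset.univ.filter fun b => (∀ n, NearLevel (a.1 n) (b.1 n)) ∧ NearLevel a.2 b.2

/-! ### The learning algorithm SPBLLA -/

/-- States `[s(t-1), s(t), x(t)]` of the algorithm: in one iteration, each UAV can only have moved
inside its constrained strategy set. -/
abbrev State (G : UAVNetwork) : Type :=
  {z : G.Profile × G.Profile × (Fin G.M → Bool) // ∀ i, z.2.1 i ∈ G.moves i (z.1 i)}

instance (G : UAVNetwork) : DecidableEq G.State := Classical.decEq _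

/-- The state `[s, s, 0]`. -/
def restState (G : UAVNetwork) (s : G.Profile) : G.State :=
  ⟨(s, s, fun _ => false), fun i => by simp [moves, NearLevel]⟩

/-- The probability `ω = (e^{-1/τ})^m` of altering the strategy. -/
def alterProb (m τ : ℝ) : ℝ := Real.exp (-(1 / τ)) ^ m

/-- The probability, in the state `z`, that UAV `i` has the strategy `a` and the flag
`x_i = x` in the next state.

If the current flag is `0`, then UAV `i` experiments with probability `ω`: it selects a strategy
uniformly in its constrained strategy set and sets its flag to `1`; otherwise it keeps its strategy
and its flag. If the current flag is `1`, then it chooses between `s_i(t-1)` and `s_i(t)`, with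
probabilities proportional to `exp (U_i(s(t-1)) / τ)` and `exp (U_i(s(t)) / τ)`, and
sets its flag to `0`. -/
def playerProb (G : UAVNetwork) (m τ : ℝ) (z : G.State) (i : Fin G.M)
    (a : G.Strategy i) (x : Bool) : ℝ :=
  let s₀ := z.1.1
  let s₁ := z.1.2.1
  let w₀ := Real.exp (1 / τ * G.utility i s₀)
  let w₁ := Real.exp (1 / τ * G.utility i s₁)
  match z.1.2.2 i, x with
  | false, false => if a = s₁ i then 1 - alterProb m τ else 0
  | false, true =>
      if a ∈ G.moves i (s₁ i) then alterProb m τ / ((G.moves i (s₁ i)).card : ℝ) else 0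
  | true, false =>
      (if a = s₀ i then w₀ / (w₀ + w₁) else 0) + (if a = s₁ i then w₁ / (w₀ + w₁) else 0)
  | true, true => 0

/-- The transition matrix of SPBLLA with probability index `m` and dynamic degree index `τ`: all
UAVs act simultaneously and independently. -/
def spblla (G : UAVNetwork) (m τ : ℝ) : Matrix G.State G.State ℝ :=
  Matrix.of fun z z' =>
    if z'.1.1 = z.1.2.1 then ∏ i, G.playerProb m τ z i (z'.1.2.1 i) (z'.1.2.2 i) else 0

/-- SPBLLA as a process with noise `ε = e^{-1/τ}`, that is, `τ = -1 / log ε`. -/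
def spbllaNoise (G : UAVNetwork) (m ε : ℝ) : Matrix G.State G.State ℝ :=
  G.spblla m (-(1 / Real.log ε))

/-- Convergence of SPBLLA with probability index `m`, with respect to the potential `φ`: the
algorithm is a regular perturbed Markov process, its stationary distribution is unique and
converges as the noise vanishes, the stochastically stable states are exactly the rest points at
maximizers of `φ`, and these maximizers are pure strategy Nash equilibria. -/
structure Converges (G : UAVNetwork) (m : ℝ) (φ : G.Profile → ℝ) : Prop where
  regular : IsRegularPerturbed (G.spbllaNoise m)
  stationary : ∀ ε ∈ Set.Ioo (0 : ℝ) 1, ∃! ν : G.State → ℝ, IsStationaryDistribution (G.spbllaNoise m ε) ν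
  limit : ∃ l : G.State → ℝ, ∀ ν : ℝ → G.State → ℝ,
    (∀ ε ∈ Set.Ioo (0 : ℝ) 1, IsStationaryDistribution (G.spbllaNoise m ε) (ν ε)) →
      Tendsto ν (𝓝[>] 0) (𝓝 l)
  stable_iff : ∀ z : G.State, IsStochasticallyStable (G.spbllaNoise m) z ↔
    ∃ s : G.Profile, z = G.restState s ∧ IsMaximizer φ s
  psne : ∀ s : G.Profile, IsMaximizer φ s → IsPSNE G.utility s

/-! ### The bound on the change of the utility -/

/-- The bound `Δ` for UAV `i`, where `π d` is the contribution of the coverage utility `D̃`. -/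
def deltaWith (G : UAVNetwork) (d : ℝ) (i : Fin G.M) : ℝ :=
  G.A * G.E * (G.ΔP / ((∑ n, G.chan i n) * G.P₁ * (G.P₁ + G.ΔP)))
    + G.B * G.μ * ((∑ n, G.chan i n) * G.ΔP)
    + G.B * G.μ * G.γ * G.ΔP * ∑ n, (∑ j ∈ Finset.univ.erase i, G.chan j n) * G.chan i n
    + G.B * G.α * Real.pi * Real.tan G.θ ^ 2 * (2 * G.hTop * G.Δh - G.Δh ^ 2)
    + G.B * G.α * G.κ * ((G.M : ℝ) - 1) * Real.pi * Real.tan G.θ ^ 2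
        * (2 * G.hTop * G.Δh - G.Δh ^ 2)
    + G.C / G.D * Real.pi * d

/-- `Δ` when the air turbulence index has the same value `b` at all altitudes. -/
def delta (G : UAVNetwork) (b : ℝ) (i : Fin G.M) : ℝ :=
  G.deltaWith (Real.tan G.θ ^ (2 * b) * (G.hTop ^ (2 * b) - (G.hTop - G.Δh) ^ (2 * b))) i

/-- `Δ` for an arbitrary air turbulence index: the last term is the largest change of `D̃` between
adjacent altitude levels. -/
def deltaVar (G : UAVNetwork) (i : Fin G.M) : ℝ :=
  G.deltaWith (⨆ p : {p : Fin G.nh × Fin G.nh // NearLevel p.1 p.2},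
    |(G.altLevel p.1.1 * Real.tan G.θ) ^ (2 * G.β p.1.1)
      - (G.altLevel p.1.2 * Real.tan G.θ) ^ (2 * G.β p.1.2)|) i

end UAVNetwork

end

/-! The utility separates as U_i(s) = f_i(s_i) + g_i(s_{-i}) (`utility_eq`). Hence φ = Σ f_i is an
exact potential, every other one differs from it by a constant, and maximizers of a potential are
equilibria. The bounds on the change of U_i add a bound for f_i and a bound for g_i. Convergence
needs only the second one, `crossBound`: it suffices that m > 2Λ with Λ = max_i `crossBound i`. This
is why a constant β < 1/2 is admissible for convergence although Δ then need not bound the change of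
utility.

Let T = 1/τ, so that ω = e^{-Tm}, and write m = 2Λ + 8η. No resistance trees are used; the
stationary distribution ν is estimated directly. Let π(s) = (∏_i number of moves of UAV i) ·
e^{Tφ(s)}. This measure is reversible for the dynamics in which, at rest, one UAV at a time
experiments and then decides. The aim is that ρ = ν/π, on rest states, is constant up to a relative
error of order e^{-4ηT}.

(a) A priori bound. Each state gets a product weight, e^{Tφ} at the strategies before pending
experiments, with a penalty of nearly m per active UAV. Transitions into a non-rest state lose a
factor e^{-Tη} against the weights (`stateWeight_mul_kernel_le`). So ν/weight is maximal at a rest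
state, and the other states have negligible mass (`exists_restState_max`). Let R be this maximum.

(b) Balance. Stationarity is tested against the expectation of h(s) after the pending experiments
are decided and no new ones begin (`sum_increment_eq_zero`). Iterations without experiments
contribute nothing (`increment_noFlags`). Single experiments at rest give ω times a Dirichlet form
in ρ and h (`sum_mul_increment_flag`). All other iterations involve at least two experiments.

(c) Cuts. Take h to be the indicator of ρ > t, and let K be the largest value of min(φ(s), φ(s'))
over the edges ss' that cross this cut. Since φ is a sum over UAVs, the flow of a multiple
experiment from r to u is at most R e^{T(φ(c)-2q)}, q = m-2η-Λ, for every profile c that mixes r and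
u. If the flow crosses the cut, then so does some edge of this box, and the flow is at most R
e^{T(K-2q)} (`mul_abs_sub_le_of_cut`). The best crossing edge contributes at least a constant times
e^{T(K-m)} times its jump of ρ. As 2q - m = 4η > 0, the jump is at most a constant times R e^{-4ηT}
(`exists_restRatio_le_add`).

Thus the values of ρ have no large gap, and R is at most a constant times max ρ. So ν, normalized,
is close to π on rest states and converges to a multiple of the number of joint moves on the
maximizers of φ (`exists_scale`, `tendsto_stationaryDistribution`). -/

noncomputable section

/-! ### Stationary distributions of irreducible stochastic matrices -/

section Stationary

variable {Z : Type*} [Fintype Z] [DecidableEq Z]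

lemma vecMul_pow_eq_self {P : Matrix Z Z ℝ} {v : Z → ℝ} (h : Matrix.vecMul v P = v) (k : ℕ) :
    Matrix.vecMul v (P ^ k) = v := by
  induction k with
  | zero => simp
  | succ k ih => rw [pow_succ, ← Matrix.vecMul_vecMul, ih, h]

lemma sum_vecMul_of_mem_rowStochastic {P : Matrix Z Z ℝ} (hP : P ∈ Matrix.rowStochastic ℝ Z)
    (v : Z → ℝ) : ∑ z, Matrix.vecMul v P z = ∑ z, v z := by
  simp only [Matrix.vecMul, dotProduct]
  rw [Finset.sum_comm]
  refine Finset.sum_congr rfl fun y _ => ?_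
  rw [← Finset.mul_sum, Matrix.sum_row_of_mem_rowStochastic hP, mul_one]

/-- The triangle inequality gives |v| ≤ |v|P entrywise. Both sides have the same total mass, so
equality holds everywhere. -/
lemma abs_vecMul_eq_self {P : Matrix Z Z ℝ} (hP : P ∈ Matrix.rowStochastic ℝ Z) {v : Z → ℝ}
    (h : Matrix.vecMul v P = v) : Matrix.vecMul |v| P = |v| := by
  have hle : ∀ z ∈ Finset.univ, |v| z ≤ Matrix.vecMul |v| P z := by
    intro z _
    conv_lhs => rw [← h]
    simp only [Pi.abs_apply, Matrix.vecMul, dotProduct]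
    refine (Finset.abs_sum_le_sum_abs _ _).trans (Finset.sum_le_sum fun y _ => ?_)
    rw [abs_mul, abs_of_nonneg (Matrix.nonneg_of_mem_rowStochastic hP)]
  have := (Finset.sum_eq_sum_iff_of_le hle).1 (sum_vecMul_of_mem_rowStochastic hP |v|).symm
  exact funext fun z => (this z (Finset.mem_univ z)).symm

/-- A nonnegative invariant vector of an irreducible matrix that vanishes somewhere is zero. -/
lemma eq_zero_of_vecMul_eq_self {P : Matrix Z Z ℝ} (hI : P.IsIrreducible) {v : Z → ℝ}
    (h : Matrix.vecMul v P = v) (hv : ∀ z, 0 ≤ v z) {z₀ : Z} (h0 : v z₀ = 0) (z : Z) : v z = 0 := by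
  obtain ⟨k, -, hk⟩ := (Matrix.isIrreducible_iff_exists_pow_pos hI.nonneg).1 hI z z₀
  have h1 := congrFun (vecMul_pow_eq_self h k) z₀
  rw [h0] at h1
  simp only [Matrix.vecMul, dotProduct] at h1
  rw [Finset.sum_eq_zero_iff_of_nonneg fun y _ =>
    mul_nonneg (hv y) (Matrix.pow_apply_nonneg hI.nonneg k y z₀)] at h1
  exact (mul_eq_zero.1 (h1 z (Finset.mem_univ z))).resolve_right hk.ne'

/-- The constant vector is a right eigenvector for the eigenvalue 1, so P - 1 is singular and has a
left null vector as well. -/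
lemma exists_vecMul_eq_self [Nonempty Z] {P : Matrix Z Z ℝ} (hP : P ∈ Matrix.rowStochastic ℝ Z) :
    ∃ v : Z → ℝ, v ≠ 0 ∧ Matrix.vecMul v P = v := by
  have hdet : (P - 1).det = 0 := by
    refine Matrix.exists_mulVec_eq_zero_iff.1 ⟨1, one_ne_zero, ?_⟩
    rw [Matrix.sub_mulVec, (Matrix.mem_rowStochastic.1 hP).2, Matrix.one_mulVec, sub_self]
  obtain ⟨v, hv, h⟩ := Matrix.exists_vecMul_eq_zero_iff.2 hdet
  refine ⟨v, hv, ?_⟩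
  rwa [Matrix.vecMul_sub, Matrix.vecMul_one, sub_eq_zero] at h

/-- Existence: normalize the absolute value of an invariant vector. Uniqueness: the difference of
two solutions has sum 0, so its positive part vanishes somewhere; being invariant, it vanishes
everywhere, and a nonpositive vector of sum 0 is 0. -/
lemma existsUnique_isStationaryDistribution [Nonempty Z] {P : Matrix Z Z ℝ}
    (hP : P ∈ Matrix.rowStochastic ℝ Z) (hI : P.IsIrreducible) :
    ∃! ν : Z → ℝ, IsStationaryDistribution P ν := by
  obtain ⟨v, hv, h⟩ := exists_vecMul_eq_self hP
  have habs := abs_vecMul_eq_self hP h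
  have hs : 0 < ∑ z, |v| z := by
    obtain ⟨z, hz⟩ := Function.ne_iff.1 hv
    exact Finset.sum_pos' (fun z _ => abs_nonneg _) ⟨z, Finset.mem_univ z, abs_pos.2 hz⟩
  refine ⟨(∑ z, |v| z)⁻¹ • |v|, ⟨fun z => ?_, ?_, ?_⟩, ?_⟩
  · exact mul_nonneg (inv_nonneg.2 hs.le) (abs_nonneg _)
  · simp only [Pi.smul_apply, smul_eq_mul, ← Finset.mul_sum]
    exact inv_mul_cancel₀ hs.ne'
  · rw [Matrix.smul_vecMul, habs]
  have key : ∀ μ ν : Z → ℝ, IsStationaryDistribution P μ → IsStationaryDistribution P ν →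
      μ = ν := by
    rintro μ ν ⟨-, hμ1, hμ⟩ ⟨-, hν1, hν⟩
    have hd : Matrix.vecMul (μ - ν) P = μ - ν := by rw [Matrix.sub_vecMul, hμ, hν]
    have hda := abs_vecMul_eq_self hP hd
    have hsum : ∑ z, (μ - ν) z = 0 := by simp [Finset.sum_sub_distrib, hμ1, hν1]
    -- the positive part of `μ - ν` vanishes somewhere
    have hpos : Matrix.vecMul (|μ - ν| + (μ - ν)) P = |μ - ν| + (μ - ν) := by
      rw [Matrix.add_vecMul, hda, hd]
    have hex : ∃ z, (μ - ν) z ≤ 0 := by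
      by_contra! hcon
      exact (Finset.sum_pos (fun z _ => hcon z) Finset.univ_nonempty).ne' hsum
    obtain ⟨z₀, hz₀⟩ := hex
    have hnp : ∀ z ∈ Finset.univ, (μ - ν) z ≤ 0 := by
      intro z _
      have := eq_zero_of_vecMul_eq_self hI hpos
        (fun z => by simpa using neg_le_iff_add_nonneg.1 (neg_le_abs ((μ - ν) z)))
        (z₀ := z₀) (by simp only [Pi.add_apply, Pi.abs_apply, abs_of_nonpos hz₀]; ring) z
      simp only [Pi.add_apply, Pi.abs_apply] at this
      linarith [abs_nonneg ((μ - ν) z)]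
    have hz := (Finset.sum_eq_zero_iff_of_nonpos hnp).1 hsum
    exact funext fun z => sub_eq_zero.1 (hz z (Finset.mem_univ z))
  intro μ hμ
  refine key _ _ hμ ⟨fun z => mul_nonneg (inv_nonneg.2 hs.le) (abs_nonneg _), ?_, ?_⟩
  · simp only [Pi.smul_apply, smul_eq_mul, ← Finset.mul_sum]
    exact inv_mul_cancel₀ hs.ne'
  · rw [Matrix.smul_vecMul, habs]

lemma pow_add_apply_pos {P : Matrix Z Z ℝ} (hP : ∀ y z, 0 ≤ P y z) {a b c : Z} {k l : ℕ}
    (h₁ : 0 < (P ^ k) a b) (h₂ : 0 < (P ^ l) b c) : 0 < (P ^ (k + l)) a c := by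
  rw [pow_add, Matrix.mul_apply]
  exact Finset.sum_pos' (fun y _ => mul_nonneg (Matrix.pow_apply_nonneg hP k a y)
    (Matrix.pow_apply_nonneg hP l y c)) ⟨b, Finset.mem_univ b, mul_pos h₁ h₂⟩

/-- An irreducible matrix with a positive diagonal entry is aperiodic. -/
lemma isAperiodic_of_apply_self_pos {P : Matrix Z Z ℝ} (hI : P.IsIrreducible) {y : Z}
    (hy : 0 < P y y) : IsAperiodic P := by
  intro z d hd
  obtain ⟨k, hk, hzy⟩ := (Matrix.isIrreducible_iff_exists_pow_pos hI.nonneg).1 hI z y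
  obtain ⟨l, -, hyz⟩ := (Matrix.isIrreducible_iff_exists_pow_pos hI.nonneg).1 hI y z
  -- Closed walks from z through y, without and with one use of the loop at y, have consecutive
  -- lengths.
  have h1 := hd (k + l) (by omega) (pow_add_apply_pos hI.nonneg hzy hyz)
  have h2 := hd (k + 1 + l) (by omega)
    (pow_add_apply_pos hI.nonneg (pow_add_apply_pos hI.nonneg hzy (by rwa [pow_one])) hyz)
  have h3 : d ∣ 1 := by
    have := (Nat.dvd_sub h2 h1)
    rwa [show k + 1 + l - (k + l) = 1 by omega] at this
  exact Nat.dvd_one.1 h3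

end Stationary

namespace UAVNetwork

variable (G : UAVNetwork)

/-! ### The game is separable -/

/-- The total power of UAV `i` under the strategy `a`. -/
def totalPower (i : Fin G.M) (a : G.Strategy i) : ℝ := ∑ n, G.powerLevel (a.1 n)

/-- The area covered from the altitude level `k`. -/
def levelCoverage (k : Fin G.nh) : ℝ := Real.pi * (G.altLevel k * Real.tan G.θ) ^ 2

/-- The part of the utility of UAV `i` that depends on its own strategy. -/
def ownUtility (i : Fin G.M) (a : G.Strategy i) : ℝ :=
  G.A * (G.E / G.totalPower i a)
    + G.B * (G.μ * G.totalPower i a - G.α * G.levelCoverage a.2)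
    + G.C * (G.coverageUtility a.2 / G.D)

/-- The part of the utility of UAV `i` that depends on the strategies of the other UAVs. -/
def crossUtility (i : Fin G.M) (s : G.Profile) : ℝ :=
  - (G.B * G.μ * G.γ * ∑ n, (∑ j ∈ Finset.univ.erase i, G.power s j n + G.noise n) * G.chan i n)
    + G.B * G.α * G.κ * ∑ j ∈ Finset.univ.erase i, G.coverage s j

lemma chan_nonneg (i : Fin G.M) (n : Fin G.N) : 0 ≤ G.chan i n := by
  unfold chan; split_ifs <;> norm_num

lemma chan_mul_self (i : Fin G.M) (n : Fin G.N) : G.chan i n * G.chan i n = G.chan i n := by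
  unfold chan; split_ifs <;> norm_num

lemma power_mul_chan (s : G.Profile) (i : Fin G.M) (n : Fin G.N) :
    G.power s i n * G.chan i n = G.power s i n := by
  unfold power chan; split_ifs <;> norm_num

lemma sum_power (s : G.Profile) (i : Fin G.M) : ∑ n, G.power s i n = G.totalPower i (s i) := by
  unfold power totalPower
  rw [← Finset.sum_subset (Finset.subset_univ (G.sel i))
    fun n _ hn => by simp [hn], ← Finset.sum_coe_sort]
  refine Finset.sum_congr rfl fun n _ => ?_
  simp [n.2]

lemma interaction_mul_chan (s : G.Profile) (i : Fin G.M) (n : Fin G.N) :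
    G.interaction s i n * G.chan i n =
      (∑ j ∈ Finset.univ.erase i, G.power s j n + G.noise n) * G.chan i n := by
  unfold interaction sigma
  rw [mul_assoc, chan_mul_self, ← Finset.add_sum_erase _ _ (Finset.mem_univ i)]
  ring

/-- This separation is behind everything that follows: the own power cancels in σ - P_i, and the
coverage correction involves the other UAVs only additively. -/
lemma utility_eq (i : Fin G.M) (s : G.Profile) :
    G.utility i s = G.ownUtility i (s i) + G.crossUtility i s := by
  have h : ∑ n, (G.power s i n - G.γ * G.interaction s i n) * G.chan i n =
      G.totalPower i (s i) - G.γ *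
        ∑ n, (∑ j ∈ Finset.univ.erase i, G.power s j n + G.noise n) * G.chan i n := by
    rw [← sum_power, Finset.mul_sum, ← Finset.sum_sub_distrib]
    refine Finset.sum_congr rfl fun n _ => ?_
    rw [sub_mul, power_mul_chan, mul_assoc, interaction_mul_chan]
  unfold utility
  rw [h, sum_power]
  unfold ownUtility crossUtility trueCoverage coverage levelCoverage
  ring

lemma crossUtility_congr {i : Fin G.M} {s s' : G.Profile} (h : ∀ j, j ≠ i → s j = s' j) :
    G.crossUtility i s = G.crossUtility i s' := by
  unfold crossUtility
  congr 2
  · congr 1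
    refine Finset.sum_congr rfl fun n _ => ?_
    congr 2
    refine Finset.sum_congr rfl fun j hj => ?_
    simp only [power, h j (Finset.ne_of_mem_erase hj)]
  · refine Finset.sum_congr rfl fun j hj => ?_
    simp only [coverage, h j (Finset.ne_of_mem_erase hj)]

/-- The canonical potential. -/
def potential (s : G.Profile) : ℝ := ∑ i, G.ownUtility i (s i)

lemma potential_update_sub (s : G.Profile) (i : Fin G.M) (a : G.Strategy i) :
    G.potential (Function.update s i a) - G.potential s
      = G.ownUtility i a - G.ownUtility i (s i) := by
  unfold potential
  rw [← Finset.sum_sub_distrib, Finset.sum_eq_single i]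
  · simp
  · intro j _ hj
    simp [Function.update_of_ne hj]
  · simp

lemma isPotential_potential : IsPotential G.utility G.potential := by
  intro i s a
  rw [potential_update_sub, utility_eq, utility_eq,
    G.crossUtility_congr (s := Function.update s i a) (s' := s)
      fun j hj => Function.update_of_ne hj _ _]
  simp

/-- A function on profiles that no unilateral change affects is constant. -/
lemma eq_of_update_eq {ι : Type*} [Fintype ι] [DecidableEq ι] {S : ι → Type*} {β : Type*}
    {g : (∀ i, S i) → β} (h : ∀ s i a, g (Function.update s i a) = g s) (s t : ∀ i, S i) :
    g s = g t := by
  have key : ∀ I : Finset ι, g (fun i => if i ∈ I then t i else s i) = g s := by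
    intro I
    induction I using Finset.induction_on with
    | empty => simp
    | insert j I hj ih =>
      rw [← ih, ← h (fun i => if i ∈ I then t i else s i) j (t j)]
      congr 1
      funext i
      by_cases hi : i = j
      · subst hi; simp
      · simp [hi]
  simpa using (key Finset.univ).symm

/-- The difference of two exact potentials is unaffected by unilateral changes, hence constant. -/
lemma isMaximizer_iff_potential {φ : G.Profile → ℝ} (hφ : IsPotential G.utility φ)
    (s : G.Profile) : IsMaximizer φ s ↔ IsMaximizer G.potential s := by
  have h : ∀ s t, φ s - G.potential s = φ t - G.potential t := by
    refine eq_of_update_eq (g := fun s => φ s - G.potential s) fun s i a => ?_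
    have h1 := hφ i s a
    have h2 := G.isPotential_potential i s a
    linarith
  unfold IsMaximizer
  exact forall_congr' fun t => by have := h s t; constructor <;> intro <;> linarith

lemma isPSNE_of_isMaximizer {ι : Type*} [DecidableEq ι] {S : ι → Type*}
    {U : ι → (∀ i, S i) → ℝ} {φ : (∀ i, S i) → ℝ} (hφ : IsPotential U φ) {s : ∀ i, S i}
    (hs : IsMaximizer φ s) : IsPSNE U s := fun i a => by
  have h1 := hφ i s a
  have h2 := hs (Function.update s i a)
  linarith

/-! ### Levels -/

lemma two_le_nh_cast : (2 : ℝ) ≤ G.nh := by exact_mod_cast G.two_le_nh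

lemma tan_pos : 0 < Real.tan G.θ := Real.tan_pos_of_pos_of_lt_pi_div_two G.θ_pos G.θ_lt

lemma altLevel_pos (k : Fin G.nh) : 0 < G.altLevel k := by
  have := G.h₁_pos
  have := G.Δh_pos
  unfold altLevel
  positivity

lemma powerLevel_ge (k : Fin G.np) : G.P₁ ≤ G.powerLevel k := by
  have := G.ΔP_pos
  have : 0 ≤ (k : ℝ) * G.ΔP := by positivity
  unfold powerLevel
  linarith

lemma NearLevel.abs_sub_le {n : ℕ} {k l : Fin n} (h : NearLevel k l) :
    |(l : ℝ) - (k : ℝ)| ≤ 1 := by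
  have h1 : ((k : ℕ) : ℝ) ≤ ((l : ℕ) : ℝ) + 1 := by exact_mod_cast h.1
  have h2 : ((l : ℕ) : ℝ) ≤ ((k : ℕ) : ℝ) + 1 := by exact_mod_cast h.2
  rw [abs_le]; constructor <;> linarith

lemma NearLevel.symm {n : ℕ} {k l : Fin n} (h : NearLevel k l) : NearLevel l k := ⟨h.2, h.1⟩

lemma NearLevel.refl {n : ℕ} (k : Fin n) : NearLevel k k := ⟨by omega, by omega⟩

lemma abs_powerLevel_sub_le {k l : Fin G.np} (h : NearLevel k l) :
    |G.powerLevel l - G.powerLevel k| ≤ G.ΔP := by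
  have : G.powerLevel l - G.powerLevel k = ((l : ℝ) - (k : ℝ)) * G.ΔP := by
    unfold powerLevel; ring
  rw [this, abs_mul, abs_of_pos G.ΔP_pos]
  exact mul_le_of_le_one_left G.ΔP_pos.le h.abs_sub_le

lemma altLevel_le_hTop (k : Fin G.nh) : G.altLevel k ≤ G.hTop := by
  unfold altLevel hTop
  have h : ((k : ℕ) : ℝ) + 1 ≤ G.nh := by exact_mod_cast k.2
  have := mul_le_mul_of_nonneg_right (show ((k : ℕ) : ℝ) ≤ (G.nh : ℝ) - 1 by linarith) G.Δh_pos.le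
  linarith

lemma hTop_sub_nonneg : 0 ≤ G.hTop - G.Δh := by
  unfold hTop
  have := G.h₁_pos
  have := mul_le_mul_of_nonneg_right (show (1 : ℝ) ≤ (G.nh : ℝ) - 1 by
    linarith [G.two_le_nh_cast]) G.Δh_pos.le
  linarith

/-- Adjacent altitude levels, in increasing order, are `x` and `x + Δh ≤ h_{nh}`. -/
lemma altLevel_cases {k l : Fin G.nh} (h : NearLevel k l) :
    G.altLevel l = G.altLevel k ∨ G.altLevel l = G.altLevel k + G.Δh ∨
      G.altLevel k = G.altLevel l + G.Δh := by
  have : (l : ℕ) = k ∨ (l : ℕ) = k + 1 ∨ (k : ℕ) = l + 1 := by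
    obtain ⟨h1, h2⟩ := h; omega
  unfold altLevel
  rcases this with h | h | h
  · left; rw [h]
  · right; left; rw [h]; push_cast; ring
  · right; right; rw [h]; push_cast; ring

/-- For an increasing function with increasing increments, the largest change between adjacent
altitude levels is at the top. -/
lemma abs_sub_altLevel_le {g : ℝ → ℝ}
    (hg : ∀ x y, 0 ≤ x → x ≤ y → g (x + G.Δh) - g x ≤ g (y + G.Δh) - g y)
    (hm : ∀ x, 0 ≤ x → g x ≤ g (x + G.Δh)) {k l : Fin G.nh} (h : NearLevel k l) :
    |g (G.altLevel l) - g (G.altLevel k)| ≤ g G.hTop - g (G.hTop - G.Δh) := by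
  have key : ∀ k l : Fin G.nh, G.altLevel l = G.altLevel k + G.Δh →
      |g (G.altLevel l) - g (G.altLevel k)| ≤ g G.hTop - g (G.hTop - G.Δh) := by
    intro k l e
    have h0 := (G.altLevel_pos k).le
    have h1 := G.altLevel_le_hTop l
    have h2 := hg (G.altLevel k) (G.hTop - G.Δh) h0 (by linarith)
    rw [sub_add_cancel] at h2
    rw [e, abs_of_nonneg (sub_nonneg.2 (hm _ h0))]
    exact h2
  rcases G.altLevel_cases h with e | e | e
  · rw [e, sub_self, abs_zero]
    have := hm _ G.hTop_sub_nonneg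
    rw [sub_add_cancel] at this
    linarith
  · exact key _ _ e
  · rw [abs_sub_comm]; exact key _ _ e

/-! ### The change of the utility in one iteration -/

/-- The largest change of `π (h tan θ)²` between adjacent altitude levels. -/
def coverageStep : ℝ :=
  Real.pi * Real.tan G.θ ^ 2 * (2 * G.hTop * G.Δh - G.Δh ^ 2)

lemma abs_levelCoverage_sub_le {k l : Fin G.nh} (h : NearLevel k l) :
    |G.levelCoverage l - G.levelCoverage k| ≤ G.coverageStep := by
  have hΔ := G.Δh_pos
  have := G.abs_sub_altLevel_le (g := fun x => Real.pi * (x * Real.tan G.θ) ^ 2)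
    (fun x y _ hxy => by
      have : 0 ≤ Real.pi * Real.tan G.θ ^ 2 * (2 * G.Δh * (y - x)) :=
        mul_nonneg (by positivity) (mul_nonneg (by positivity) (by linarith))
      linarith)
    (fun x hx => by
      have := G.tan_pos
      have : x * Real.tan G.θ ≤ (x + G.Δh) * Real.tan G.θ :=
        mul_le_mul_of_nonneg_right (by linarith) this.le
      have h0 : 0 ≤ x * Real.tan G.θ := by positivity
      gcongr) h
  refine this.trans (le_of_eq ?_)
  unfold coverageStep
  ring

lemma coverageStep_nonneg : 0 ≤ G.coverageStep :=
  (abs_nonneg _).trans (G.abs_levelCoverage_sub_le (NearLevel.refl ⟨0, by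
    have := G.two_le_nh; omega⟩))

lemma mem_moves {i : Fin G.M} {a b : G.Strategy i} :
    b ∈ G.moves i a ↔ (∀ n, NearLevel (a.1 n) (b.1 n)) ∧ NearLevel a.2 b.2 := by
  simp [moves]

lemma mem_moves_self (i : Fin G.M) (a : G.Strategy i) : a ∈ G.moves i a :=
  G.mem_moves.2 ⟨fun _ => NearLevel.refl _, NearLevel.refl _⟩

lemma mem_moves_comm {i : Fin G.M} {a b : G.Strategy i} :
    b ∈ G.moves i a ↔ a ∈ G.moves i b := by
  rw [mem_moves, mem_moves]
  exact ⟨fun h => ⟨fun n => (h.1 n).symm, h.2.symm⟩, fun h => ⟨fun n => (h.1 n).symm, h.2.symm⟩⟩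

lemma abs_power_sub_le {s s' : G.Profile} (h : ∀ j, s' j ∈ G.moves j (s j)) (j : Fin G.M)
    (n : Fin G.N) : |G.power s' j n - G.power s j n| ≤ G.ΔP * G.chan j n := by
  unfold power chan
  split_ifs with hn
  · rw [mul_one]
    exact G.abs_powerLevel_sub_le ((G.mem_moves.1 (h j)).1 ⟨n, hn⟩)
  · simp

/-- The bound on the change of the utility of UAV `i` caused by the moves of the other UAVs. -/
def crossBound (i : Fin G.M) : ℝ :=
  G.B * G.μ * G.γ * G.ΔP * ∑ n, (∑ j ∈ Finset.univ.erase i, G.chan j n) * G.chan i n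
    + G.B * G.α * G.κ * ((G.M : ℝ) - 1) * G.coverageStep

lemma abs_crossUtility_sub_le {s s' : G.Profile} (h : ∀ j, s' j ∈ G.moves j (s j))
    (i : Fin G.M) : |G.crossUtility i s' - G.crossUtility i s| ≤ G.crossBound i := by
  have hB := G.B_nonneg
  have hμ := G.μ_nonneg
  have hγ := G.γ_nonneg
  have hα := G.α_nonneg
  have hκ := G.κ_nonneg
  have h1 : |∑ n, (∑ j ∈ Finset.univ.erase i, G.power s' j n + G.noise n) * G.chan i n
      - ∑ n, (∑ j ∈ Finset.univ.erase i, G.power s j n + G.noise n) * G.chan i n|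
      ≤ G.ΔP * ∑ n, (∑ j ∈ Finset.univ.erase i, G.chan j n) * G.chan i n := by
    rw [← Finset.sum_sub_distrib, Finset.mul_sum]
    refine (Finset.abs_sum_le_sum_abs _ _).trans (Finset.sum_le_sum fun n _ => ?_)
    rw [← sub_mul, abs_mul, abs_of_nonneg (G.chan_nonneg i n), ← mul_assoc]
    refine mul_le_mul_of_nonneg_right ?_ (G.chan_nonneg i n)
    rw [add_sub_add_right_eq_sub, ← Finset.sum_sub_distrib, Finset.mul_sum]
    exact (Finset.abs_sum_le_sum_abs _ _).trans
      (Finset.sum_le_sum fun j _ => G.abs_power_sub_le h j n)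
  have h2 : |∑ j ∈ Finset.univ.erase i, G.coverage s' j
      - ∑ j ∈ Finset.univ.erase i, G.coverage s j| ≤ ((G.M : ℝ) - 1) * G.coverageStep := by
    rw [← Finset.sum_sub_distrib]
    refine (Finset.abs_sum_le_sum_abs _ _).trans ((Finset.sum_le_card_nsmul _ _ _
      fun j _ => G.abs_levelCoverage_sub_le (G.mem_moves.1 (h j)).2).trans (le_of_eq ?_))
    rw [Finset.card_erase_of_mem (Finset.mem_univ i), Finset.card_univ, Fintype.card_fin,
      nsmul_eq_mul, Nat.cast_pred G.M_pos]
  have e : G.crossUtility i s' - G.crossUtility i s =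
      -(G.B * G.μ * G.γ * (∑ n, (∑ j ∈ Finset.univ.erase i, G.power s' j n + G.noise n)
        * G.chan i n - ∑ n, (∑ j ∈ Finset.univ.erase i, G.power s j n + G.noise n) * G.chan i n))
      + G.B * G.α * G.κ * (∑ j ∈ Finset.univ.erase i, G.coverage s' j
        - ∑ j ∈ Finset.univ.erase i, G.coverage s j) := by
    unfold crossUtility; ring
  rw [e]
  refine (abs_add_le _ _).trans ?_
  rw [abs_neg, abs_mul (G.B * G.μ * G.γ), abs_mul (G.B * G.α * G.κ),
    abs_of_nonneg (show 0 ≤ G.B * G.μ * G.γ by positivity),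
    abs_of_nonneg (show 0 ≤ G.B * G.α * G.κ by positivity)]
  unfold crossBound
  have h3 := mul_le_mul_of_nonneg_left h1 (show 0 ≤ G.B * G.μ * G.γ by positivity)
  have h4 := mul_le_mul_of_nonneg_left h2 (show 0 ≤ G.B * G.α * G.κ by positivity)
  linarith

/-- It bounds an absolute value, for instance when nobody moves. -/
lemma crossBound_nonneg (i : Fin G.M) : 0 ≤ G.crossBound i := by
  obtain ⟨k⟩ : Nonempty (Fin G.np) := ⟨⟨0, G.np_pos⟩⟩
  obtain ⟨l⟩ : Nonempty (Fin G.nh) := ⟨⟨0, by have := G.two_le_nh; omega⟩⟩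
  exact (abs_nonneg _).trans (G.abs_crossUtility_sub_le (s := fun _ => (fun _ => k, l))
    (fun j => G.mem_moves_self j _) i)

/-! ### Change of the part of the utility that depends on the own strategy -/

lemma sum_chan (i : Fin G.M) : ∑ n, G.chan i n = ((G.sel i).card : ℝ) := by
  simp [chan]

lemma sum_chan_pos (i : Fin G.M) : 0 < ∑ n, G.chan i n := by
  rw [sum_chan]
  exact_mod_cast (G.sel_nonempty i).card_pos

lemma totalPower_ge (i : Fin G.M) (a : G.Strategy i) :
    (∑ n, G.chan i n) * G.P₁ ≤ G.totalPower i a := by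
  rw [sum_chan]
  unfold totalPower
  have := Finset.card_nsmul_le_sum Finset.univ (fun n => G.powerLevel (a.1 n)) G.P₁
    fun n _ => G.powerLevel_ge _
  rwa [nsmul_eq_mul, Finset.card_univ, Fintype.card_coe] at this

lemma abs_totalPower_sub_le {i : Fin G.M} {a b : G.Strategy i} (h : b ∈ G.moves i a) :
    |G.totalPower i b - G.totalPower i a| ≤ (∑ n, G.chan i n) * G.ΔP := by
  rw [sum_chan]
  unfold totalPower
  rw [← Finset.sum_sub_distrib]
  refine (Finset.abs_sum_le_sum_abs _ _).trans ((Finset.sum_le_card_nsmul _ _ _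
      fun n _ => G.abs_powerLevel_sub_le ((G.mem_moves.1 h).1 n)).trans (le_of_eq ?_))
  rw [nsmul_eq_mul, Finset.card_univ, Fintype.card_coe]

/-- The difference grows with y, so y = x + kd is the worst case; there it equals kd / (x(x + kd)),
which decreases in x, so x = kp is the worst case. -/
lemma inv_sub_inv_le {k p d x y : ℝ} (hk : 0 < k) (hp : 0 < p) (hd : 0 < d) (hx : k * p ≤ x)
    (hxy : x ≤ y) (hyx : y - x ≤ k * d) : 1 / x - 1 / y ≤ d / (k * p * (p + d)) := by
  have hkp : 0 < k * p := by positivity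
  have hx0 : 0 < x := by linarith
  have hy0 : 0 < y := by linarith
  have h1 : 1 / x - 1 / y ≤ 1 / x - 1 / (x + k * d) := by
    have : 1 / (x + k * d) ≤ 1 / y := one_div_le_one_div_of_le hy0 (by linarith)
    linarith
  refine h1.trans ?_
  have hkd : 0 < k * d := by positivity
  have e1 : 1 / x - 1 / (x + k * d) = k * d / (x * (x + k * d)) := by field_simp; ring
  have e2 : d / (k * p * (p + d)) = k * d / ((k * p) * (k * p + k * d)) := by field_simp
  rw [e1, e2]
  gcongr

lemma abs_ownUtility_sub_le {i : Fin G.M} {a b : G.Strategy i} (h : b ∈ G.moves i a) :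
    |G.ownUtility i b - G.ownUtility i a| ≤
      G.A * G.E * (G.ΔP / ((∑ n, G.chan i n) * G.P₁ * (G.P₁ + G.ΔP)))
        + G.B * G.μ * ((∑ n, G.chan i n) * G.ΔP) + G.B * G.α * G.coverageStep
        + G.C / G.D * |G.coverageUtility b.2 - G.coverageUtility a.2| := by
  have hA := G.A_nonneg
  have hE := G.E_nonneg
  have hB := G.B_nonneg
  have hC := G.C_nonneg
  have hμ := G.μ_nonneg
  have hα := G.α_nonneg
  have hD := G.D_pos
  have h1 : |1 / G.totalPower i b - 1 / G.totalPower i a| ≤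
      G.ΔP / ((∑ n, G.chan i n) * G.P₁ * (G.P₁ + G.ΔP)) := by
    have hk := G.sum_chan_pos i
    have ha := G.totalPower_ge i a
    have hb := G.totalPower_ge i b
    have hab := abs_le.1 (G.abs_totalPower_sub_le h)
    have hkp : 0 < (∑ n, G.chan i n) * G.P₁ := mul_pos hk G.P₁_pos
    rcases le_total (G.totalPower i a) (G.totalPower i b) with hle | hle
    · rw [abs_sub_comm, abs_of_nonneg (sub_nonneg.2
        (one_div_le_one_div_of_le (hkp.trans_le ha) hle))]
      exact inv_sub_inv_le hk G.P₁_pos G.ΔP_pos ha hle hab.2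
    · rw [abs_of_nonneg (sub_nonneg.2 (one_div_le_one_div_of_le (hkp.trans_le hb) hle))]
      exact inv_sub_inv_le hk G.P₁_pos G.ΔP_pos hb hle (by linarith)
  have h2 := G.abs_totalPower_sub_le h
  have h3 := G.abs_levelCoverage_sub_le (G.mem_moves.1 h).2
  have e : G.ownUtility i b - G.ownUtility i a =
      G.A * G.E * (1 / G.totalPower i b - 1 / G.totalPower i a)
        + G.B * G.μ * (G.totalPower i b - G.totalPower i a)
        + -(G.B * G.α * (G.levelCoverage b.2 - G.levelCoverage a.2))
        + G.C / G.D * (G.coverageUtility b.2 - G.coverageUtility a.2) := by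
    unfold ownUtility; ring
  rw [e]
  refine (abs_add_le _ _).trans (add_le_add ((abs_add_le _ _).trans
    (add_le_add ((abs_add_le _ _).trans (add_le_add ?_ ?_)) ?_)) ?_)
  · rw [abs_mul, abs_of_nonneg (show 0 ≤ G.A * G.E by positivity)]
    gcongr
  · rw [abs_mul, abs_of_nonneg (show 0 ≤ G.B * G.μ by positivity)]
    gcongr
  · rw [abs_neg, abs_mul, abs_of_nonneg (show 0 ≤ G.B * G.α by positivity)]
    gcongr
  · rw [abs_mul, abs_of_nonneg (show 0 ≤ G.C / G.D by positivity)]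

/-- The summands are regrouped into the effect of the own move and the effect of the moves of the
others. -/
lemma deltaWith_eq (d : ℝ) (i : Fin G.M) : G.deltaWith d i =
    G.A * G.E * (G.ΔP / ((∑ n, G.chan i n) * G.P₁ * (G.P₁ + G.ΔP)))
        + G.B * G.μ * ((∑ n, G.chan i n) * G.ΔP) + G.B * G.α * G.coverageStep
        + G.C / G.D * (Real.pi * d) + G.crossBound i := by
  unfold deltaWith crossBound coverageStep
  ring

/-- All remaining summands of Δ are nonnegative. This is the only property of Δ that convergence
uses. -/
lemma crossBound_le_deltaWith {d : ℝ} (hd : 0 ≤ d) (i : Fin G.M) :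
    G.crossBound i ≤ G.deltaWith d i := by
  have hA := G.A_nonneg
  have hE := G.E_nonneg
  have hB := G.B_nonneg
  have hC := G.C_nonneg
  have hμ := G.μ_nonneg
  have hα := G.α_nonneg
  have hD := G.D_pos
  have hk := G.sum_chan_pos i
  have hP := G.P₁_pos
  have hΔ := G.ΔP_pos
  have hs := G.coverageStep_nonneg
  rw [deltaWith_eq, le_add_iff_nonneg_left]
  positivity

/-- The utility changes by at most `Δ(d)` in one iteration if `(h tan θ)^{2β}` changes by at most
`d` between adjacent levels. -/
lemma abs_utility_sub_le {d : ℝ}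
    (hd : ∀ k l : Fin G.nh, NearLevel k l →
      |(G.altLevel l * Real.tan G.θ) ^ (2 * G.β l)
        - (G.altLevel k * Real.tan G.θ) ^ (2 * G.β k)| ≤ d)
    {s s' : G.Profile} (h : ∀ j, s' j ∈ G.moves j (s j)) (i : Fin G.M) :
    |G.utility i s' - G.utility i s| ≤ G.deltaWith d i := by
  have hC := G.C_nonneg
  have hD := G.D_pos
  have h1 := G.abs_crossUtility_sub_le h i
  have h2 := G.abs_ownUtility_sub_le (h i)
  have h3 : |G.coverageUtility (s' i).2 - G.coverageUtility (s i).2| ≤ Real.pi * d := by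
    unfold coverageUtility
    rw [← mul_sub, abs_mul, abs_of_pos Real.pi_pos]
    exact mul_le_mul_of_nonneg_left (hd _ _ (G.mem_moves.1 (h i)).2) Real.pi_pos.le
  have h4 := mul_le_mul_of_nonneg_left h3 (show 0 ≤ G.C / G.D by positivity)
  rw [utility_eq, utility_eq, add_sub_add_comm, deltaWith_eq]
  refine (abs_add_le _ _).trans ?_
  linarith

lemma bddAbove_coverage_steps :
    BddAbove (Set.range fun p : {p : Fin G.nh × Fin G.nh // NearLevel p.1 p.2} =>
      |(G.altLevel p.1.1 * Real.tan G.θ) ^ (2 * G.β p.1.1)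
        - (G.altLevel p.1.2 * Real.tan G.θ) ^ (2 * G.β p.1.2)|) :=
  (Set.finite_range _).bddAbove

lemma abs_utility_sub_le_deltaVar {s s' : G.Profile} (h : ∀ j, s' j ∈ G.moves j (s j))
    (i : Fin G.M) : |G.utility i s' - G.utility i s| ≤ G.deltaVar i :=
  G.abs_utility_sub_le (fun k l hkl =>
    le_ciSup G.bddAbove_coverage_steps ⟨(l, k), hkl.symm⟩) h i

lemma crossBound_le_deltaVar (i : Fin G.M) : G.crossBound i ≤ G.deltaVar i :=
  G.crossBound_le_deltaWith (Real.iSup_nonneg fun _ => abs_nonneg _) i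

/-- Monotonicity of x ↦ x^{2b} suffices here, since only the sign of the last summand matters.
Convexity, and with it b ≥ 1/2, is not needed. -/
lemma crossBound_le_delta {b : ℝ} (hb : 0 ≤ b) (i : Fin G.M) :
    G.crossBound i ≤ G.delta b i := by
  refine G.crossBound_le_deltaWith (mul_nonneg (Real.rpow_nonneg G.tan_pos.le _)
    (sub_nonneg.2 (Real.rpow_le_rpow G.hTop_sub_nonneg ?_ (by linarith)))) i
  linarith [G.Δh_pos]

/-- The increments of a convex function increase. -/
lemma increment_le_of_convexOn {g : ℝ → ℝ} (hg : ConvexOn ℝ (Set.Ici 0) g) {x y d : ℝ} (hx : 0 ≤ x)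
    (hxy : x ≤ y) (hd : 0 < d) : g (x + d) - g x ≤ g (y + d) - g y := by
  rcases hxy.eq_or_lt with rfl | hlt
  · rfl
  have hL : 0 < y + d - x := by linarith
  have hx' : x ∈ Set.Ici (0 : ℝ) := hx
  have hy' : y + d ∈ Set.Ici (0 : ℝ) := show 0 ≤ y + d by linarith
  have hp : 0 ≤ (y - x) / (y + d - x) := div_nonneg (by linarith) hL.le
  have hq : 0 ≤ d / (y + d - x) := div_nonneg hd.le hL.le
  -- `x + d` and `y` are complementary convex combinations of `x` and `y + d`
  have h1 := hg.2 hx' hy' hp hq (by field_simp; ring)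
  have h2 := hg.2 hx' hy' hq hp (by field_simp; ring)
  simp only [smul_eq_mul] at h1 h2
  rw [show (y - x) / (y + d - x) * x + d / (y + d - x) * (y + d) = x + d by field_simp; ring] at h1
  rw [show d / (y + d - x) * x + (y - x) / (y + d - x) * (y + d) = y by field_simp; ring] at h2
  have h3 : (y - x) / (y + d - x) * g x + d / (y + d - x) * g (y + d)
      + (d / (y + d - x) * g x + (y - x) / (y + d - x) * g (y + d)) = g x + g (y + d) := by
    field_simp; ring
  linarith

/-- For b ≥ 1/2 the function x ↦ x^{2b} is convex and increasing, so its largest step is the top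
one. -/
lemma abs_utility_sub_le_delta {b : ℝ} (hβ : ∀ k, G.β k = b) (hb : 1 / 2 ≤ b)
    {s s' : G.Profile} (h : ∀ j, s' j ∈ G.moves j (s j))
    (i : Fin G.M) : |G.utility i s' - G.utility i s| ≤ G.delta b i := by
  refine G.abs_utility_sub_le (fun k l hkl => ?_) h i
  have ht := G.tan_pos
  rw [hβ, hβ, Real.mul_rpow (G.altLevel_pos k).le ht.le, Real.mul_rpow (G.altLevel_pos l).le ht.le,
    ← sub_mul, abs_mul, abs_of_nonneg (Real.rpow_nonneg ht.le (2 * b)), mul_comm]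
  refine mul_le_mul_of_nonneg_left ?_ (Real.rpow_nonneg ht.le _)
  refine G.abs_sub_altLevel_le (g := fun x => x ^ (2 * b)) (fun x y hx hxy => ?_)
    (fun x hx => ?_) hkl
  · exact increment_le_of_convexOn (convexOn_rpow (by linarith)) hx hxy G.Δh_pos
  · exact Real.rpow_le_rpow hx (by linarith [G.Δh_pos]) (by linarith)

/-! ### Connectivity of the strategy sets -/

lemma eq_of_nearLevel_eq {n : ℕ} {β : Type*} {g : Fin n → β}
    (h : ∀ k l, NearLevel k l → g l = g k) (k l : Fin n) : g k = g l := by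
  have key : ∀ (j : ℕ) (hj : j < n), g ⟨j, hj⟩ = g ⟨0, by omega⟩ := by
    intro j
    induction j with
    | zero => intro _; rfl
    | succ j ih =>
      intro hj
      rw [← ih (by omega)]
      exact h _ _ ⟨by simp; omega, by simp⟩
  rw [key k.1 k.2, key l.1 l.2]

/-- The altitude and the power in each channel can be changed separately, one level at a time. -/
lemma eq_of_moves_eq {i : Fin G.M} {β : Type*} {g : G.Strategy i → β}
    (h : ∀ a, ∀ b ∈ G.moves i a, g b = g a) (a b : G.Strategy i) : g a = g b := by
  have h1 : ∀ p k l, g (p, k) = g (p, l) := fun p =>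
    eq_of_nearLevel_eq fun k l hkl => h _ _ (G.mem_moves.2 ⟨fun _ => NearLevel.refl _, hkl⟩)
  have h2 : ∀ k p q, g (p, k) = g (q, k) := by
    intro k
    refine eq_of_update_eq fun p n l => ?_
    have := eq_of_nearLevel_eq (g := fun l => g (Function.update p n l, k))
      (fun k' l' hkl => h _ _ (G.mem_moves.2 ⟨fun n' => ?_, NearLevel.refl _⟩)) l (p n)
    · simpa using this
    · by_cases hn : n' = n
      · subst hn; simpa using hkl
      · simpa [hn] using NearLevel.refl _
  obtain ⟨p, k⟩ := a
  obtain ⟨q, l⟩ := b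
  rw [h1 p k l, h2 l p q]

/-- A function on profiles that is invariant under unilateral moves is constant. -/
lemma eq_of_update_moves_eq {β : Type*} {g : G.Profile → β}
    (h : ∀ s i, ∀ a ∈ G.moves i (s i), g (Function.update s i a) = g s) (s t : G.Profile) :
    g s = g t := by
  refine eq_of_update_eq (fun s i a => ?_) s t
  have := G.eq_of_moves_eq (g := fun a => g (Function.update s i a))
    (fun a b hb => by simpa using h (Function.update s i a) i b (by simpa using hb)) a (s i)
  simpa using this

/-! ### Transition probabilities as functions of `T = 1 / τ` -/

/-- The probability `ω` as a function of `T = 1 / τ`. -/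
def omega (m T : ℝ) : ℝ := Real.exp (-(T * m))

lemma omega_pos (m T : ℝ) : 0 < omega m T := Real.exp_pos _

lemma omega_lt_one {m T : ℝ} (hm : 0 < m) (hT : 0 < T) : omega m T < 1 := by
  have := mul_pos hT hm
  exact Real.exp_lt_one_iff.2 (by linarith)

/-- The probability that UAV `i`, if it does not experiment, has the strategy `a` in the next
iteration. -/
def evalProb (T : ℝ) (s₀ s₁ : G.Profile) (i : Fin G.M) (x : Bool) (a : G.Strategy i) : ℝ :=
  let w₀ := Real.exp (T * G.utility i s₀)
  let w₁ := Real.exp (T * G.utility i s₁)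
  if x then
    (if a = s₀ i then w₀ / (w₀ + w₁) else 0) + (if a = s₁ i then w₁ / (w₀ + w₁) else 0)
  else if a = s₁ i then 1 else 0

/-- The probability that UAV `i` has the strategy `a` and the flag `y` in the next iteration. -/
def stepProb (m T : ℝ) (s₀ s₁ : G.Profile) (i : Fin G.M) (x : Bool) (a : G.Strategy i)
    (y : Bool) : ℝ :=
  if y then
    if x then 0
    else if a ∈ G.moves i (s₁ i) then omega m T / ((G.moves i (s₁ i)).card : ℝ) else 0
  else (if x then 1 else 1 - omega m T) * G.evalProb T s₀ s₁ i x a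

/-- The transition matrix of SPBLLA as a function of `T = 1 / τ`. -/
def kernel (m T : ℝ) : Matrix G.State G.State ℝ :=
  Matrix.of fun z z' =>
    if z'.1.1 = z.1.2.1 then
      ∏ i, G.stepProb m T z.1.1 z.1.2.1 i (z.1.2.2 i) (z'.1.2.1 i) (z'.1.2.2 i) else 0

/-- With ε = e^{-T}, the limit of vanishing noise becomes T → ∞, and all transition probabilities
are elementary in e^T. -/
lemma spbllaNoise_eq_kernel (m ε : ℝ) : G.spbllaNoise m ε = G.kernel m (-Real.log ε) := by
  have hT : 1 / -(1 / Real.log ε) = -Real.log ε := by rw [one_div_neg_eq_neg_one_div, one_div_one_div]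
  have hω : alterProb m (-(1 / Real.log ε)) = omega m (-Real.log ε) := by
    unfold alterProb omega
    rw [hT, ← Real.exp_mul]
    ring_nf
  ext z z'
  simp only [spbllaNoise, spblla, kernel, Matrix.of_apply]
  split_ifs with h
  · refine Finset.prod_congr rfl fun i _ => ?_
    unfold playerProb stepProb evalProb
    rw [hT, hω]
    rcases z.1.2.2 i <;> rcases z'.1.2.2 i <;> simp
  · rfl

variable {G}

lemma card_moves_pos {i : Fin G.M} {a : G.Strategy i} : 0 < ((G.moves i a).card : ℝ) := by
  exact_mod_cast Finset.card_pos.2 ⟨a, G.mem_moves_self i a⟩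

lemma evalProb_nonneg (T : ℝ) (s₀ s₁ : G.Profile) (i : Fin G.M) (x : Bool) (a : G.Strategy i) :
    0 ≤ G.evalProb T s₀ s₁ i x a := by
  unfold evalProb
  positivity

lemma evalProb_false (T : ℝ) (s₀ s₁ : G.Profile) (i : Fin G.M) (a : G.Strategy i) :
    G.evalProb T s₀ s₁ i false a = if a = s₁ i then 1 else 0 := by
  simp [evalProb]

lemma sum_evalProb (T : ℝ) (s₀ s₁ : G.Profile) (i : Fin G.M) (x : Bool) :
    ∑ a, G.evalProb T s₀ s₁ i x a = 1 := by
  unfold evalProb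
  cases x
  · simp
  · simp only [if_true, Finset.sum_add_distrib, Finset.sum_ite_eq', Finset.mem_univ]
    rw [← add_div, div_self (by positivity)]

lemma evalProb_le_one (T : ℝ) (s₀ s₁ : G.Profile) (i : Fin G.M) (x : Bool) (a : G.Strategy i) :
    G.evalProb T s₀ s₁ i x a ≤ 1 := by
  rw [← sum_evalProb T s₀ s₁ i x]
  exact Finset.single_le_sum (f := fun a => G.evalProb T s₀ s₁ i x a)
    (fun b _ => evalProb_nonneg T s₀ s₁ i x b) (Finset.mem_univ a)

lemma eq_or_eq_of_evalProb_ne_zero {T : ℝ} {s₀ s₁ : G.Profile} {i : Fin G.M} {x : Bool}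
    {a : G.Strategy i} (h : G.evalProb T s₀ s₁ i x a ≠ 0) :
    (x = true ∧ a = s₀ i) ∨ a = s₁ i := by
  by_contra! hc
  cases x <;> simp_all [evalProb]

lemma mem_moves_of_evalProb_ne_zero {T : ℝ} {s₀ s₁ : G.Profile} {i : Fin G.M} {x : Bool}
    {a : G.Strategy i} (hs : s₁ i ∈ G.moves i (s₀ i)) (h : G.evalProb T s₀ s₁ i x a ≠ 0) :
    a ∈ G.moves i (s₁ i) := by
  rcases eq_or_eq_of_evalProb_ne_zero h with ⟨-, rfl⟩ | rfl
  · exact G.mem_moves_comm.1 hs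
  · exact G.mem_moves_self _ _

/-! ### Transition probabilities of a single UAV -/

section Step

variable {m T : ℝ} {s₀ s₁ : G.Profile} {i : Fin G.M} {x : Bool} {a : G.Strategy i} {y : Bool}

lemma stepProb_nonneg (hm : 0 < m) (hT : 0 < T) : 0 ≤ G.stepProb m T s₀ s₁ i x a y := by
  have h0 := omega_pos m T
  have h1 := omega_lt_one hm hT
  have h2 := evalProb_nonneg T s₀ s₁ i x a
  unfold stepProb
  split_ifs
  · exact le_rfl
  · positivity
  · exact le_rfl
  · linarith
  · exact mul_nonneg (by linarith) h2

lemma stepProb_false_le :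
    G.stepProb m T s₀ s₁ i x a false ≤ G.evalProb T s₀ s₁ i x a := by
  have h0 := omega_pos m T
  have h2 := evalProb_nonneg T s₀ s₁ i x a
  unfold stepProb
  simp only [Bool.false_eq_true, if_false]
  refine mul_le_of_le_one_left h2 ?_
  split_ifs <;> linarith

lemma stepProb_true_le : G.stepProb m T s₀ s₁ i x a true ≤ omega m T := by
  have h0 := omega_pos m T
  unfold stepProb
  simp only [if_true]
  split_ifs
  · exact h0.le
  · refine div_le_self h0.le ?_
    exact_mod_cast Finset.card_pos.2 ⟨_, G.mem_moves_self i _⟩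
  · exact h0.le

lemma stepProb_true_true : G.stepProb m T s₀ s₁ i true a true = 0 := by simp [stepProb]

lemma mem_moves_of_stepProb_ne_zero (hs : s₁ i ∈ G.moves i (s₀ i))
    (h : G.stepProb m T s₀ s₁ i x a y ≠ 0) : a ∈ G.moves i (s₁ i) := by
  unfold stepProb at h
  split_ifs at h with h1 h2 h3 h4
  · exact absurd rfl h
  · exact h3
  · exact absurd rfl h
  · exact mem_moves_of_evalProb_ne_zero hs (right_ne_zero_of_mul h)
  · exact mem_moves_of_evalProb_ne_zero hs (right_ne_zero_of_mul h)

lemma sum_stepProb : ∑ y, ∑ a, G.stepProb m T s₀ s₁ i x a y = 1 := by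
  have h1 : ∑ a, G.stepProb m T s₀ s₁ i x a false = if x then 1 else 1 - omega m T := by
    simp only [stepProb, Bool.false_eq_true, if_false, ← Finset.mul_sum, sum_evalProb, mul_one]
  have h2 : ∑ a, G.stepProb m T s₀ s₁ i x a true = if x then 0 else omega m T := by
    cases x
    · simp only [stepProb, if_true, Bool.false_eq_true, if_false, ← Finset.sum_filter,
        Finset.sum_const, Finset.filter_mem_eq_inter, Finset.univ_inter, nsmul_eq_mul]
      exact mul_div_cancel₀ _ card_moves_pos.ne'
    · simp [stepProb]
  rw [Fintype.sum_bool, h1, h2]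
  cases x <;> simp

lemma stepProb_stay_pos (hm : 0 < m) (hT : 0 < T) :
    0 < G.stepProb m T s₀ s₁ i x (s₁ i) false := by
  have := omega_lt_one hm hT
  cases x
  · simpa [stepProb, evalProb] using this
  · simp only [stepProb, evalProb, if_true, Bool.false_eq_true, if_false, one_mul]
    positivity

lemma stepProb_return_pos : 0 < G.stepProb m T s₀ s₁ i true (s₀ i) false := by
  simp only [stepProb, evalProb, if_true, Bool.false_eq_true, if_false, one_mul]
  positivity

lemma stepProb_experiment_pos (ha : a ∈ G.moves i (s₁ i)) :
    0 < G.stepProb m T s₀ s₁ i false a true := by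
  have := omega_pos m T
  have : 0 < ((G.moves i (s₁ i)).card : ℝ) := card_moves_pos
  simp only [stepProb, if_true, Bool.false_eq_true, if_false, ha]
  positivity

end Step

/-- The probability of the next profile `s₂` and the next flags `x'`, from the profiles `s₀`, `s₁`
and the flags `x`. -/
def jointProb (m T : ℝ) (s₀ s₁ : G.Profile) (x : Fin G.M → Bool) (s₂ : G.Profile)
    (x' : Fin G.M → Bool) : ℝ := ∏ i, G.stepProb m T s₀ s₁ i (x i) (s₂ i) (x' i)

lemma jointProb_nonneg {m T : ℝ} (hm : 0 < m) (hT : 0 < T) {s₀ s₁ : G.Profile}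
    {x : Fin G.M → Bool} {s₂ : G.Profile} {x' : Fin G.M → Bool} :
    0 ≤ jointProb m T s₀ s₁ x s₂ x' := Finset.prod_nonneg fun _ _ => stepProb_nonneg hm hT

lemma sum_prod_apply {ι : Type*} [Fintype ι] [DecidableEq ι] {S : ι → Type*} [∀ i, Fintype (S i)]
    (f : ∀ i, S i → ℝ) : ∑ s : ∀ i, S i, ∏ i, f i (s i) = ∏ i, ∑ a, f i a := by
  rw [Finset.prod_univ_sum, Fintype.piFinset_univ]

lemma sum_jointProb (m T : ℝ) (s₀ s₁ : G.Profile) (x : Fin G.M → Bool) :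
    ∑ x' : Fin G.M → Bool, ∑ s₂, jointProb m T s₀ s₁ x s₂ x' = 1 := by
  have h : ∀ x' : Fin G.M → Bool, ∑ s₂, jointProb m T s₀ s₁ x s₂ x' =
      ∏ i, ∑ a, G.stepProb m T s₀ s₁ i (x i) a (x' i) := fun x' =>
    sum_prod_apply fun i a => G.stepProb m T s₀ s₁ i (x i) a (x' i)
  simp only [h]
  rw [sum_prod_apply fun i b => ∑ a, G.stepProb m T s₀ s₁ i (x i) a b]
  exact Finset.prod_eq_one fun i _ => sum_stepProb

/-- The expectation of a function of the next state. -/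
lemma sum_kernel_mul (m T : ℝ) (z : G.State) (g : G.Profile → (Fin G.M → Bool) → ℝ) :
    ∑ z', G.kernel m T z z' * g z'.1.2.1 z'.1.2.2 =
      ∑ x' : Fin G.M → Bool, ∑ s₂, jointProb m T z.1.1 z.1.2.1 z.1.2.2 s₂ x' * g s₂ x' := by
  have h1 : ∑ z', G.kernel m T z z' * g z'.1.2.1 z'.1.2.2 =
      ∑ w : G.Profile × G.Profile × (Fin G.M → Bool),
        if ∀ i, w.2.1 i ∈ G.moves i (w.1 i) then
          (if w.1 = z.1.2.1 then jointProb m T z.1.1 z.1.2.1 z.1.2.2 w.2.1 w.2.2 else 0)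
            * g w.2.1 w.2.2 else 0 := by
    rw [← Finset.sum_filter]
    exact (Finset.sum_subtype (p := fun w : G.Profile × G.Profile × (Fin G.M → Bool) =>
      ∀ i, w.2.1 i ∈ G.moves i (w.1 i)) _ (by simp) fun w =>
      (if w.1 = z.1.2.1 then jointProb m T z.1.1 z.1.2.1 z.1.2.2 w.2.1 w.2.2 else 0)
            * g w.2.1 w.2.2).symm
  rw [h1, Fintype.sum_prod_type, Finset.sum_eq_single z.1.2.1, Fintype.sum_prod_type,
    Finset.sum_comm]
  · refine Finset.sum_congr rfl fun x' _ => Finset.sum_congr rfl fun s₂ _ => ?_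
    simp only [if_true]
    -- The restriction to the state space costs nothing: a step never leaves the constrained
    -- strategy sets, so the other terms vanish.
    split_ifs with h
    · rfl
    · push Not at h
      obtain ⟨i, hi⟩ := h
      have : jointProb m T z.1.1 z.1.2.1 z.1.2.2 s₂ x' = 0 := by
        refine Finset.prod_eq_zero (Finset.mem_univ i) ?_
        by_contra hne
        exact hi (mem_moves_of_stepProb_ne_zero (z.2 i) hne)
      rw [this, zero_mul]
  · intro s _ hs
    exact Finset.sum_eq_zero fun w _ => by simp [hs]
  · simp

lemma kernel_nonneg {m T : ℝ} (hm : 0 < m) (hT : 0 < T) (z z' : G.State) :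
    0 ≤ G.kernel m T z z' := by
  simp only [kernel, Matrix.of_apply]
  split_ifs
  · exact Finset.prod_nonneg fun _ _ => stepProb_nonneg hm hT
  · exact le_rfl

lemma kernel_mem_rowStochastic {m T : ℝ} (hm : 0 < m) (hT : 0 < T) :
    G.kernel m T ∈ Matrix.rowStochastic ℝ G.State := by
  refine Matrix.mem_rowStochastic_iff_sum.2 ⟨kernel_nonneg hm hT, fun z => ?_⟩
  have := sum_kernel_mul m T z fun _ _ => 1
  simp only [mul_one] at this
  rw [this, sum_jointProb]

/-! ### Irreducibility and aperiodicity -/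

lemma kernel_pos_iff {m T : ℝ} {z z' : G.State} (h : z'.1.1 = z.1.2.1)
    (hp : ∀ i, 0 < G.stepProb m T z.1.1 z.1.2.1 i (z.1.2.2 i) (z'.1.2.1 i) (z'.1.2.2 i)) :
    0 < G.kernel m T z z' := by
  simp only [kernel, Matrix.of_apply, h, if_true]
  exact Finset.prod_pos fun i _ => hp i

lemma kernel_restState_pos {m T : ℝ} (hm : 0 < m) (hT : 0 < T) (z : G.State) :
    0 < G.kernel m T z (G.restState z.1.2.1) :=
  kernel_pos_iff rfl fun _ => stepProb_stay_pos hm hT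

lemma exists_pow_pos_of_pos {Z : Type*} [Fintype Z] [DecidableEq Z] {P : Matrix Z Z ℝ} {y z : Z}
    (h : 0 < P y z) : ∃ k > 0, 0 < (P ^ k) y z := ⟨1, one_pos, by rwa [pow_one]⟩

lemma exists_pow_pos_trans {Z : Type*} [Fintype Z] [DecidableEq Z] {P : Matrix Z Z ℝ}
    (hP : ∀ y z, 0 ≤ P y z) {a b c : Z} (h₁ : ∃ k > 0, 0 < (P ^ k) a b)
    (h₂ : ∃ k > 0, 0 < (P ^ k) b c) : ∃ k > 0, 0 < (P ^ k) a c := by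
  obtain ⟨k, hk, hi⟩ := h₁
  obtain ⟨l, -, hj⟩ := h₂
  exact ⟨k + l, by omega, pow_add_apply_pos hP hi hj⟩

/-- In one iteration UAV i alone experiments with a; in the next it keeps a and nobody else
experiments. -/
lemma exists_pow_restState_update_pos {m T : ℝ} (hm : 0 < m) (hT : 0 < T) (s : G.Profile)
    {i : Fin G.M} {a : G.Strategy i} (ha : a ∈ G.moves i (s i)) :
    ∃ k > 0, 0 < (G.kernel m T ^ k) (G.restState s) (G.restState (Function.update s i a)) := by
  let z : G.State := ⟨(s, Function.update s i a, fun j => decide (j = i)), fun j => by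
    by_cases hj : j = i
    · subst hj; simpa using ha
    · simpa [hj] using G.mem_moves_self j _⟩
  refine exists_pow_pos_trans (kernel_nonneg hm hT) (b := z) (exists_pow_pos_of_pos
    (kernel_pos_iff rfl fun j => ?_)) (exists_pow_pos_of_pos (kernel_restState_pos hm hT z))
  by_cases hj : j = i
  · subst hj
    simpa [z, restState] using stepProb_experiment_pos ha
  · simpa [z, restState, hj] using stepProb_stay_pos hm hT

lemma exists_pow_restState_pos {m T : ℝ} (hm : 0 < m) (hT : 0 < T) (s t : G.Profile) :
    ∃ k > 0, 0 < (G.kernel m T ^ k) (G.restState s) (G.restState t) := by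
  have hn := kernel_nonneg (G := G) hm hT
  -- Moves are symmetric, so reachability from s is invariant under unilateral moves, as a function
  -- of the target with values in `Prop`. Connectivity makes it constant, and s is reached from s.
  have h := G.eq_of_update_moves_eq
    (g := fun t => ∃ k > 0, 0 < (G.kernel m T ^ k) (G.restState s) (G.restState t))
    (fun t i a ha => propext ⟨fun h => exists_pow_pos_trans hn h ?_, fun h =>
      exists_pow_pos_trans hn h (exists_pow_restState_update_pos hm hT t ha)⟩) s t
  · rw [← h]
    exact exists_pow_pos_of_pos (kernel_restState_pos hm hT (G.restState s))
  · have := exists_pow_restState_update_pos hm hT (Function.update t i a) (i := i) (a := t i)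
      (by simpa using G.mem_moves_comm.1 ha)
    simpa using this

/-- Every state is reached from some rest state in two iterations. -/
lemma exists_restState_pow_pos {m T : ℝ} (hm : 0 < m) (hT : 0 < T) (z : G.State) :
    ∃ r, ∃ k > 0, 0 < (G.kernel m T ^ k) (G.restState r) z := by
  obtain ⟨⟨s, s', x'⟩, hz⟩ := z
  -- A UAV with final flag 1 waits and then experiments from s to s'. One with final flag 0 and s' ≠
  -- s starts at s', experiments with s and reverts. The others stay. The flags of `y` mark the
  -- second kind.
  let r : G.Profile := fun i => if x' i then s i else s' i
  let y : G.State := ⟨(r, s, fun i => !x' i && decide (s' i ≠ s i)), fun i => by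
    cases hx : x' i
    · simpa [r, hx] using G.mem_moves_comm.1 (hz i)
    · simpa [r, hx] using G.mem_moves_self i _⟩
  refine ⟨r, exists_pow_pos_trans (kernel_nonneg hm hT) (b := y)
    (exists_pow_pos_of_pos (kernel_pos_iff rfl fun i => ?_))
    (exists_pow_pos_of_pos (kernel_pos_iff rfl fun i => ?_))⟩
  · cases hx : x' i
    · by_cases hs : s' i = s i
      · have : s i = r i := by simp [r, hx, hs]
        simp only [y, restState, hx, hs, this]
        simpa using stepProb_stay_pos hm hT
      · have := G.mem_moves_comm.1 (hz i)
        simp only [y, restState, hx]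
        simpa [hs] using stepProb_experiment_pos (by simpa [r, hx] using this)
    · have : s i = r i := by simp [r, hx]
      simp only [y, restState, hx, this]
      simpa using stepProb_stay_pos hm hT
  · cases hx : x' i
    · by_cases hs : s' i = s i
      · simp only [y, hx, hs]
        simpa using stepProb_stay_pos hm hT
      · have : s' i = r i := by simp [r, hx]
        simp only [y, hx, hs, ne_eq, not_false_eq_true, decide_true, Bool.not_false, Bool.and_self]
        rw [this]
        exact stepProb_return_pos
    · simp only [y, hx]
      simpa using stepProb_experiment_pos (hz i)

lemma kernel_isIrreducible {m T : ℝ} (hm : 0 < m) (hT : 0 < T) :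
    (G.kernel m T).IsIrreducible := by
  have hn := kernel_nonneg (G := G) hm hT
  rw [Matrix.isIrreducible_iff_exists_pow_pos hn]
  intro z z'
  obtain ⟨r, hr⟩ := exists_restState_pow_pos hm hT z'
  exact exists_pow_pos_trans hn (exists_pow_pos_of_pos (kernel_restState_pos hm hT z))
    (exists_pow_pos_trans hn (exists_pow_restState_pos hm hT _ r) hr)

instance : Nonempty (Fin G.nh) := ⟨⟨0, by have := G.two_le_nh; omega⟩⟩

instance : Nonempty (Fin G.np) := ⟨⟨0, G.np_pos⟩⟩

instance : Nonempty (Fin G.M) := ⟨⟨0, G.M_pos⟩⟩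

instance : Nonempty G.State := ⟨G.restState (Classical.arbitrary _)⟩

lemma kernel_isAperiodic {m T : ℝ} (hm : 0 < m) (hT : 0 < T) : IsAperiodic (G.kernel m T) :=
  isAperiodic_of_apply_self_pos (kernel_isIrreducible hm hT)
    (kernel_restState_pos hm hT (G.restState (Classical.arbitrary _)))

/-! ### Resistances -/

/-- `f` decays like a multiple of `exp (-R T)` with `R ≥ 0`. -/
def HasResistance (f : ℝ → ℝ) : Prop :=
  ∃ R : ℝ, 0 ≤ R ∧ ∃ c : ℝ, 0 < c ∧ Tendsto (fun T => f T * Real.exp (T * R)) atTop (𝓝 c)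

lemma HasResistance.of_tendsto {f : ℝ → ℝ} {c : ℝ} (hc : 0 < c) (h : Tendsto f atTop (𝓝 c)) :
    HasResistance f := ⟨0, le_rfl, c, hc, by simpa using h⟩

lemma HasResistance.prod {ι : Type*} [Fintype ι] {f : ι → ℝ → ℝ} (h : ∀ i, HasResistance (f i)) :
    HasResistance fun T => ∏ i, f i T := by
  choose R hR c hc ht using h
  refine ⟨∑ i, R i, Finset.sum_nonneg fun i _ => hR i, ∏ i, c i,
    Finset.prod_pos fun i _ => hc i, ?_⟩
  refine (tendsto_finsetProd Finset.univ fun i _ => ht i).congr fun T => ?_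
  rw [Finset.prod_mul_distrib, ← Real.exp_sum, Finset.mul_sum]

lemma HasResistance.exists_tendsto {f : ℝ → ℝ} (h : HasResistance f) :
    ∃ l, Tendsto f atTop (𝓝 l) := by
  obtain ⟨R, hR, c, -, ht⟩ := h
  rcases hR.eq_or_lt with rfl | hR
  · exact ⟨c, by simpa using ht⟩
  · have h1 : Tendsto (fun T : ℝ => Real.exp (-(T * R))) atTop (𝓝 0) :=
      Real.tendsto_exp_neg_atTop_nhds_zero.comp (tendsto_id.atTop_mul_const hR)
    refine ⟨c * 0, (ht.mul h1).congr fun T => ?_⟩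
    rw [mul_assoc, ← Real.exp_add, add_neg_cancel, Real.exp_zero, mul_one]

lemma tendsto_exp_mul_neg {c : ℝ} (hc : 0 < c) :
    Tendsto (fun T : ℝ => Real.exp (-(T * c))) atTop (𝓝 0) :=
  Real.tendsto_exp_neg_atTop_nhds_zero.comp (tendsto_id.atTop_mul_const hc)

/-- The resistance is max(v - u, 0); a tie gives the limit 1/2. -/
lemma HasResistance.logistic (u v : ℝ) :
    HasResistance fun T => Real.exp (T * u) / (Real.exp (T * u) + Real.exp (T * v)) := by
  rcases lt_trichotomy u v with h | rfl | h
  · refine ⟨v - u, by linarith, 1, one_pos, ?_⟩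
    have h1 := tendsto_exp_mul_neg (sub_pos.2 h)
    have h2 : Tendsto (fun T : ℝ => 1 / (Real.exp (-(T * (v - u))) + 1)) atTop (𝓝 (1 / (0 + 1))) :=
      (tendsto_const_nhds).div (h1.add tendsto_const_nhds) (by norm_num)
    rw [zero_add, div_one] at h2
    refine h2.congr fun T => ?_
    simp only
    rw [show T * v = T * u + T * (v - u) by ring, Real.exp_add, Real.exp_neg]
    have := Real.exp_pos (T * u)
    have := Real.exp_pos (T * (v - u))
    field_simp
  · refine .of_tendsto (c := 1 / 2) (by norm_num) (tendsto_const_nhds.congr fun T => ?_)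
    have := Real.exp_pos (T * u)
    field_simp
    norm_num
  · have h1 := tendsto_exp_mul_neg (sub_pos.2 h)
    have h2 : Tendsto (fun T : ℝ => 1 / (1 + Real.exp (-(T * (u - v))))) atTop (𝓝 (1 / (1 + 0))) :=
      (tendsto_const_nhds).div (tendsto_const_nhds.add h1) (by norm_num)
    rw [add_zero, div_one] at h2
    refine .of_tendsto one_pos (h2.congr fun T => ?_)
    rw [show T * u = T * v + T * (u - v) by ring, Real.exp_add, Real.exp_neg]
    have := Real.exp_pos (T * v)
    have := Real.exp_pos (T * (u - v))
    field_simp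

/-- If the two compared strategies coincide, the probabilities add up to 1 and the resistance is 0;
otherwise a single logistic term remains. -/
lemma evalProb_hasResistance (s₀ s₁ : G.Profile) (i : Fin G.M) (x : Bool) (a : G.Strategy i)
    (h : ∃ T, G.evalProb T s₀ s₁ i x a ≠ 0) :
    HasResistance fun T => G.evalProb T s₀ s₁ i x a := by
  obtain ⟨T₀, h⟩ := h
  unfold evalProb at h ⊢
  cases x
  · simp only [Bool.false_eq_true, if_false] at h ⊢
    split_ifs at h ⊢
    · exact .of_tendsto one_pos tendsto_const_nhds
    · exact absurd rfl h
  · simp only [if_true] at h ⊢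
    split_ifs at h ⊢ with h0 h1 h1
    · refine .of_tendsto one_pos (tendsto_const_nhds.congr fun T => ?_)
      rw [← add_div, div_self (by positivity)]
    · simpa using HasResistance.logistic _ _
    · simpa [add_comm] using HasResistance.logistic (G.utility i s₁) (G.utility i s₀)
    · simp at h

lemma stepProb_hasResistance {m : ℝ} (hm : 0 < m) {s₀ s₁ : G.Profile} {i : Fin G.M} {x : Bool}
    {a : G.Strategy i} {y : Bool} (h : ∃ T, G.stepProb m T s₀ s₁ i x a y ≠ 0) :
    HasResistance fun T => G.stepProb m T s₀ s₁ i x a y := by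
  obtain ⟨T₀, h⟩ := h
  have hω := tendsto_exp_mul_neg hm
  unfold stepProb at h ⊢
  split_ifs at h ⊢ with h1 h2 h3 h4
  · exact absurd rfl h
  · have hc : 0 < ((G.moves i (s₁ i)).card : ℝ) := card_moves_pos
    refine ⟨m, hm.le, 1 / ((G.moves i (s₁ i)).card : ℝ), by positivity,
      tendsto_const_nhds.congr fun T => ?_⟩
    simp only [omega]
    rw [div_mul_eq_mul_div, ← Real.exp_add, neg_add_cancel, Real.exp_zero]
  · exact absurd rfl h
  · simpa using evalProb_hasResistance s₀ s₁ i x a ⟨T₀, right_ne_zero_of_mul h⟩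
  · obtain ⟨R, hR, c, hc, ht⟩ :=
      evalProb_hasResistance s₀ s₁ i x a ⟨T₀, right_ne_zero_of_mul h⟩
    refine ⟨R, hR, c, hc, ?_⟩
    have := ((tendsto_const_nhds (x := (1 : ℝ))).sub hω).mul ht
    rw [sub_zero, one_mul] at this
    exact this.congr fun T => by simp only [omega]; ring

lemma kernel_hasResistance {m : ℝ} (hm : 0 < m) {z z' : G.State}
    (h : ∃ T, G.kernel m T z z' ≠ 0) : HasResistance fun T => G.kernel m T z z' := by
  obtain ⟨T₀, h⟩ := h
  simp only [kernel, Matrix.of_apply] at h ⊢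
  split_ifs at h ⊢
  · exact .prod fun i => stepProb_hasResistance hm
      ⟨T₀, fun h0 => h (Finset.prod_eq_zero (Finset.mem_univ i) h0)⟩
  · exact absurd rfl h

lemma tendsto_neg_log : Tendsto (fun ε => -Real.log ε) (𝓝[>] 0) atTop :=
  tendsto_neg_atBot_atTop.comp Real.tendsto_log_nhdsGT_zero

lemma neg_log_pos {ε : ℝ} (hε : ε ∈ Set.Ioo (0 : ℝ) 1) : 0 < -Real.log ε :=
  neg_pos.2 (Real.log_neg hε.1 hε.2)

lemma spbllaNoise_isRegularPerturbed {m : ℝ} (hm : 0 < m) :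
    IsRegularPerturbed (G.spbllaNoise m) := by
  have hlim : ∀ z z', ∃ l, Tendsto (fun T => G.kernel m T z z') atTop (𝓝 l) := by
    intro z z'
    by_cases h : ∃ T, G.kernel m T z z' ≠ 0
    · exact (kernel_hasResistance hm h).exists_tendsto
    · push Not at h
      exact ⟨0, tendsto_const_nhds.congr fun T => (h T).symm⟩
  choose P₀ hP₀ using hlim
  refine ⟨fun ε hε => ?_, fun ε hε => ?_, fun ε hε => ?_, ?_, fun z z' h => ?_⟩
  · rw [spbllaNoise_eq_kernel]; exact kernel_mem_rowStochastic hm (neg_log_pos hε)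
  · rw [spbllaNoise_eq_kernel]; exact kernel_isIrreducible hm (neg_log_pos hε)
  · rw [spbllaNoise_eq_kernel]; exact kernel_isAperiodic hm (neg_log_pos hε)
  · refine ⟨Matrix.of P₀, Matrix.mem_rowStochastic_iff_sum.2 ⟨fun z z' => ?_, fun z => ?_⟩, ?_⟩
    · exact ge_of_tendsto (hP₀ z z')
        ((eventually_gt_atTop 0).mono fun T hT => kernel_nonneg hm hT z z')
    · refine tendsto_nhds_unique (tendsto_finsetSum Finset.univ fun z' _ => hP₀ z z') ?_
      refine tendsto_const_nhds.congr' ((eventually_gt_atTop 0).mono fun T hT => ?_)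
      exact ((Matrix.mem_rowStochastic_iff_sum.1 (kernel_mem_rowStochastic hm hT)).2 z).symm
    · refine tendsto_pi_nhds.2 fun z => tendsto_pi_nhds.2 fun z' => ?_
      simp only [spbllaNoise_eq_kernel]
      exact (hP₀ z z').comp tendsto_neg_log
  · obtain ⟨ε₀, -, h⟩ := h
    rw [spbllaNoise_eq_kernel] at h
    obtain ⟨R, hR, c, hc, ht⟩ := kernel_hasResistance hm ⟨_, h.ne'⟩
    refine ⟨R, hR, c, hc, (ht.comp tendsto_neg_log).congr' ?_⟩
    filter_upwards [self_mem_nhdsWithin] with ε hε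
    rw [Set.mem_Ioi] at hε
    rw [spbllaNoise_eq_kernel, Real.rpow_def_of_pos hε, Function.comp_apply, div_eq_mul_inv,
      ← Real.exp_neg, neg_mul]

/-! ### Weights of the states -/

/-- UAV `i` is active if it has just experimented, or has just reverted an experiment. -/
def Active (s₀ s₁ : G.Profile) (i : Fin G.M) (x : Bool) : Prop := x = true ∨ s₀ i ≠ s₁ i

instance (s₀ s₁ : G.Profile) (i : Fin G.M) (x : Bool) : Decidable (Active s₀ s₁ i x) :=
  inferInstanceAs (Decidable (_ ∨ _))

/-- The strategy of UAV `i` before its last experiment. -/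
def base (s₀ s₁ : G.Profile) (x : Fin G.M → Bool) : G.Profile :=
  fun i => if x i then s₀ i else s₁ i

/-- The weight of the state of UAV `i`: `exp (T f_i)` at the base strategy, with a penalty of almost
`m` for an active UAV, slightly larger if it has just experimented. -/
def weight (m η T : ℝ) (s₀ s₁ : G.Profile) (i : Fin G.M) (x : Bool) : ℝ :=
  Real.exp (T * (if x then G.ownUtility i (s₀ i) - (m - η)
    else if s₀ i = s₁ i then G.ownUtility i (s₁ i) else G.ownUtility i (s₁ i) - (m - 2 * η)))

/-- The weight of a state. -/
def stateWeight (m η T : ℝ) (z : G.State) : ℝ :=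
  ∏ i, weight m η T z.1.1 z.1.2.1 i (z.1.2.2 i)

lemma weight_pos (m η T : ℝ) (s₀ s₁ : G.Profile) (i : Fin G.M) (x : Bool) :
    0 < weight m η T s₀ s₁ i x := Real.exp_pos _

lemma stateWeight_pos (m η T : ℝ) (z : G.State) : 0 < stateWeight m η T z :=
  Finset.prod_pos fun _ _ => weight_pos _ _ _ _ _ _ _

lemma exp_mul_le_exp_mul {T a b : ℝ} (hT : 0 < T) (h : a ≤ b) :
    Real.exp (T * a) ≤ Real.exp (T * b) :=
  Real.exp_le_exp.2 (mul_le_mul_of_nonneg_left h hT.le)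

/-- A UAV that compares the strategies `a` and `b` chooses the worse one with small
probability. -/
lemma evalProb_le_exp {Λ T : ℝ} (hT : 0 < T) (hΛ : 0 ≤ Λ) {s₀ s₁ : G.Profile} {i : Fin G.M}
    (hc : |G.crossUtility i s₁ - G.crossUtility i s₀| ≤ Λ) {x : Bool} {b : G.Strategy i}
    (hb : (x = true ∧ b = s₀ i) ∨ b = s₁ i) (a : G.Strategy i) :
    G.evalProb T s₀ s₁ i x a ≤ Real.exp (T * (G.ownUtility i a - G.ownUtility i b + Λ)) := by
  by_cases h0 : G.evalProb T s₀ s₁ i x a = 0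
  · rw [h0]; positivity
  by_cases hab : a = b
  · refine (evalProb_le_one T s₀ s₁ i x a).trans (Real.one_le_exp ?_)
    rw [hab, sub_self, zero_add]
    positivity
  have hc' := abs_le.1 hc
  -- A logistic probability is at most the ratio of the two exponentials. The utilities differ by
  -- the change of the own part plus a cross term of at most Λ.
  have key : ∀ u v d : ℝ, u - v ≤ d →
      Real.exp (T * u) / (Real.exp (T * u) + Real.exp (T * v)) ≤ Real.exp (T * d) := by
    intro u v d h
    have h1 : Real.exp (T * u) / (Real.exp (T * u) + Real.exp (T * v))
        ≤ Real.exp (T * u) / Real.exp (T * v) := by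
      have := Real.exp_pos (T * u)
      gcongr
      linarith
    refine h1.trans ?_
    rw [← Real.exp_sub, ← mul_sub]
    exact exp_mul_le_exp_mul hT h
  rcases eq_or_eq_of_evalProb_ne_zero h0 with ⟨rfl, ha⟩ | ha
  · have hb' : b = s₁ i := by
      rcases hb with ⟨-, hb⟩ | hb
      · exact absurd (ha.trans hb.symm) hab
      · exact hb
    have hne : s₀ i ≠ s₁ i := by rw [← ha, ← hb']; exact hab
    subst ha hb'
    simp only [evalProb, if_true, hne, if_false, add_zero]
    refine key _ _ _ ?_
    rw [utility_eq, utility_eq]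
    linarith
  · rcases hb with ⟨rfl, hb⟩ | hb
    · have hne : s₁ i ≠ s₀ i := by rw [← ha, ← hb]; exact hab
      subst ha hb
      simp only [evalProb, if_true, hne, if_false, zero_add]
      rw [add_comm (Real.exp _)]
      refine key _ _ _ ?_
      rw [utility_eq, utility_eq]
      linarith
    · exact absurd (ha.trans hb.symm) hab

lemma weight_le_base {m η T : ℝ} (hT : 0 < T) (hη : 0 ≤ η) (s₀ s₁ : G.Profile)
    (x : Fin G.M → Bool) (i : Fin G.M) : weight m η T s₀ s₁ i (x i) ≤
      Real.exp (T * (G.ownUtility i (base s₀ s₁ x i)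
        - if Active s₀ s₁ i (x i) then m - 2 * η else 0)) := by
  refine exp_mul_le_exp_mul hT ?_
  unfold base Active
  cases x i
  · by_cases h : s₀ i = s₁ i <;> simp [h]
  · simp; linarith

lemma stepProb_true_le_exp {m T : ℝ} {s₀ s₁ : G.Profile} {i : Fin G.M} {x : Bool}
    {a : G.Strategy i} : G.stepProb m T s₀ s₁ i x a true ≤ Real.exp (T * -m) := by
  rw [mul_neg]; exact stepProb_true_le

/-! ### Weights against transition probabilities, for one UAV -/

section Estimates

variable {m η Λ T : ℝ} {s₀ s₁ s₂ : G.Profile} {i : Fin G.M}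

/-- Weights absorb transition probabilities, with some room to spare if the UAV becomes or
remains active. -/
lemma weight_mul_stepProb_le (hT : 0 < T) (hΛ : 0 ≤ Λ) (hη : 0 < η) (hm : m = 2 * Λ + 8 * η)
    (hc : |G.crossUtility i s₁ - G.crossUtility i s₀| ≤ Λ) (x x' : Bool) :
    weight m η T s₀ s₁ i x * G.stepProb m T s₀ s₁ i x (s₂ i) x' ≤
      weight m η T s₁ s₂ i x' * if Active s₁ s₂ i x' then Real.exp (T * -η) else 1 := by
  have hR : 0 ≤ weight m η T s₁ s₂ i x' *
      if Active s₁ s₂ i x' then Real.exp (T * -η) else 1 := by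
    have := weight_pos m η T s₁ s₂ i x'
    positivity
  by_cases h0 : G.stepProb m T s₀ s₁ i x (s₂ i) x' = 0
  · rw [h0, mul_zero]; exact hR
  have hw := (weight_pos m η T s₀ s₁ i x).le
  have hm0 : 0 < m := by linarith
  cases x'
  · have hE := stepProb_false_le (m := m) (T := T) (s₀ := s₀) (s₁ := s₁) (i := i) (x := x)
      (a := s₂ i)
    have hE0 : G.evalProb T s₀ s₁ i x (s₂ i) ≠ 0 := fun h => h0 (by simp [stepProb, h])
    refine (mul_le_mul_of_nonneg_left hE hw).trans ?_
    by_cases h2 : s₂ i = s₁ i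
    · have hna : ¬ Active s₁ s₂ i false := by simp [Active, h2]
      rw [if_neg hna, mul_one]
      cases x
      · refine (mul_le_of_le_one_right hw (evalProb_le_one _ _ _ _ _ _)).trans ?_
        refine exp_mul_le_exp_mul hT ?_
        simp only [Bool.false_eq_true, if_false, h2, if_true]
        split_ifs <;> linarith
      -- The experiment is accepted: the base moves from s₀ to s₁ with an error of at most Λ, which
      -- the penalty m - η, now dropped, covers.
      · refine (mul_le_mul_of_nonneg_left
          (evalProb_le_exp hT hΛ hc (Or.inl ⟨rfl, rfl⟩) _) hw).trans ?_
        unfold weight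
        rw [← Real.exp_add, ← mul_add]
        refine exp_mul_le_exp_mul hT ?_
        simp only [Bool.false_eq_true, if_false, h2, if_true]
        linarith
    -- The experiment is reverted: the base stays, and the exponents agree exactly because m - η =
    -- (m - 2η) + η. This is why the two penalties differ by η.
    · have ha : Active s₁ s₂ i false := Or.inr (Ne.symm h2)
      obtain ⟨rfl, h3⟩ := (eq_or_eq_of_evalProb_ne_zero hE0).resolve_right h2
      rw [if_pos ha]
      refine (mul_le_of_le_one_right hw (evalProb_le_one _ _ _ _ _ _)).trans ?_
      unfold weight
      rw [← Real.exp_add, ← mul_add]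
      refine exp_mul_le_exp_mul hT ?_
      have hne : s₁ i ≠ s₀ i := by rw [← h3]; exact Ne.symm h2
      simp only [Bool.false_eq_true, if_false, if_true, h3, hne]
      linarith
  -- A new experiment costs e^{-Tm}, which pays for the penalty m - η and for the spare factor
  -- e^{-Tη}.
  · have ha : Active s₁ s₂ i true := Or.inl rfl
    rw [if_pos ha]
    cases x
    · refine (mul_le_mul_of_nonneg_left stepProb_true_le_exp hw).trans ?_
      unfold weight
      rw [← Real.exp_add, ← Real.exp_add, ← mul_add, ← mul_add]
      refine exp_mul_le_exp_mul hT ?_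
      simp only [Bool.false_eq_true, if_false, if_true]
      split_ifs <;> linarith
    · exact absurd stepProb_true_true h0

/-- The number of experiments that are accounted for by the activity of UAV `i` and by its next
flag. -/
def experiments (s₀ s₁ : G.Profile) (i : Fin G.M) (x x' : Bool) : ℕ :=
  (if Active s₀ s₁ i x then 1 else 0) + if x' then 1 else 0

/-- A pending experiment ends at u. Its cost can be read from either end: at the base, bound the
probability by 1; at u, use the logistic estimate, at the price Λ. The free choice of c for each UAV
is what the box argument for cuts needs. -/
lemma weight_mul_evalProb_le (hT : 0 < T) (hΛ : 0 ≤ Λ) (hη : 0 < η)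
    (hc : |G.crossUtility i s₁ - G.crossUtility i s₀| ≤ Λ) {x : Fin G.M → Bool} (hx : x i = true)
    {u c : G.Strategy i} (hcu : c = base s₀ s₁ x i ∨ c = u) :
    weight m η T s₀ s₁ i (x i) * G.evalProb T s₀ s₁ i (x i) u ≤
      Real.exp (T * (G.ownUtility i c - (m - 2 * η - Λ))) := by
  have hw := (weight_pos m η T s₀ s₁ i (x i)).le
  rcases hcu with rfl | rfl
  · refine (mul_le_of_le_one_right hw (evalProb_le_one _ _ _ _ _ _)).trans ?_
    refine exp_mul_le_exp_mul hT ?_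
    simp only [base, hx, if_true]
    linarith
  · refine (mul_le_mul_of_nonneg_left
      (evalProb_le_exp hT hΛ hc (Or.inl ⟨hx, rfl⟩) _) hw).trans ?_
    unfold weight
    rw [← Real.exp_add, ← mul_add]
    refine exp_mul_le_exp_mul hT ?_
    simp only [hx, if_true]
    linarith

/-- The strategies `u` that are reached after one more evaluation have, together with the base
strategy, a large weight compared to the probability to reach them. -/
lemma weight_mul_stepProb_mul_evalProb_next_le (hT : 0 < T) (hΛ : 0 ≤ Λ) (hη : 0 < η)
    (hm : m = 2 * Λ + 8 * η) (hc : |G.crossUtility i s₁ - G.crossUtility i s₀| ≤ Λ)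
    (hc' : |G.crossUtility i s₂ - G.crossUtility i s₁| ≤ Λ) (x : Fin G.M → Bool) (x' : Bool)
    {u c : G.Strategy i} (hcu : c = base s₀ s₁ x i ∨ c = u) :
    weight m η T s₀ s₁ i (x i) * G.stepProb m T s₀ s₁ i (x i) (s₂ i) x'
        * G.evalProb T s₁ s₂ i x' u ≤
      Real.exp (T * (G.ownUtility i c
        - (experiments s₀ s₁ i (x i) x' : ℝ) * (m - 2 * η - Λ))) := by
  have hm0 : 0 < m := by linarith
  have hw := (weight_pos m η T s₀ s₁ i (x i)).le
  have hp := stepProb_nonneg (s₀ := s₀) (s₁ := s₁) (i := i) (x := x i) (a := s₂ i) (y := x') hm0 hT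
  have he := evalProb_nonneg T s₁ s₂ i x' u
  by_cases h0 : G.stepProb m T s₀ s₁ i (x i) (s₂ i) x' = 0
  · rw [h0, mul_zero, zero_mul]; positivity
  by_cases h1 : G.evalProb T s₁ s₂ i x' u = 0
  · rw [h1, mul_zero]; positivity
  cases hx : x i
  · have hb : base s₀ s₁ x i = s₁ i := by simp [base, hx]
    have hwb := weight_le_base (m := m) hT hη.le s₀ s₁ x i
    rw [hb, hx] at hwb
    rw [hb] at hcu
    rw [hx] at hw hp h0
    cases x'
    -- Nothing is pending and nothing begins, so all strategies agree; a UAV that has just reverted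
    -- still carries its penalty.
    · have h2 : s₂ i = s₁ i := by
        have : G.evalProb T s₀ s₁ i false (s₂ i) ≠ 0 := fun h => h0 (by simp [stepProb, h])
        simpa using eq_or_eq_of_evalProb_ne_zero this
      have h3 : u = s₁ i := by
        simpa [h2] using eq_or_eq_of_evalProb_ne_zero h1
      have hc1 : c = s₁ i := by rcases hcu with h | h <;> simp [h, h3]
      have hp1 : G.stepProb m T s₀ s₁ i false (s₂ i) false ≤ 1 :=
        stepProb_false_le.trans (evalProb_le_one _ _ _ _ _ _)
      refine (mul_le_of_le_one_right (mul_nonneg hw hp) (evalProb_le_one _ _ _ _ _ _)).trans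
        ((mul_le_of_le_one_right hw hp1).trans (hwb.trans (exp_mul_le_exp_mul hT ?_)))
      rw [hc1, experiments]
      split_ifs <;> first | contradiction | (push_cast; linarith)
    -- A new experiment from s₁ to s₂, decided afterwards. The profiles compared in that decision
    -- are s₁ and s₂, so the cross terms of this pair enter if c = u.
    · have hstep := mul_le_mul hwb (stepProb_true_le_exp (m := m) (T := T) (s₀ := s₀) (s₁ := s₁)
        (i := i) (x := false) (a := s₂ i)) hp (by positivity)
      rw [← Real.exp_add, ← mul_add] at hstep
      rcases hcu with hcu | hcu
      · refine (mul_le_of_le_one_right (mul_nonneg hw hp) (evalProb_le_one _ _ _ _ _ _)).trans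
          (hstep.trans (exp_mul_le_exp_mul hT ?_))
        rw [hcu, experiments]
        split_ifs <;> push_cast <;> linarith
      · refine (mul_le_mul hstep (evalProb_le_exp hT hΛ hc' (Or.inl ⟨rfl, rfl⟩) u) he
          (by positivity)).trans ?_
        rw [← Real.exp_add, ← mul_add]
        refine exp_mul_le_exp_mul hT ?_
        rw [hcu, experiments]
        split_ifs <;> push_cast <;> linarith
  -- A pending experiment is decided now, so no new one can begin, and s₂ is already the outcome u.
  · have hx' : x' = false := by
      cases x'
      · rfl
      · exact absurd (by rw [hx]; exact stepProb_true_true) h0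
    subst hx'
    have h3 : u = s₂ i := by simpa using eq_or_eq_of_evalProb_ne_zero h1
    refine (mul_le_of_le_one_right (mul_nonneg (hx ▸ hw) (hx ▸ hp))
      (evalProb_le_one _ _ _ _ _ _)).trans
      ((mul_le_mul_of_nonneg_left stepProb_false_le (hx ▸ hw)).trans ?_)
    have := weight_mul_evalProb_le (m := m) hT hΛ hη hc hx hcu
    rw [h3, hx] at this
    refine this.trans (exp_mul_le_exp_mul hT ?_)
    simp [experiments, Active]

/-- The analogue for the strategies `u` that are reached without a further experiment. -/
lemma weight_mul_stepProb_mul_evalProb_le (hT : 0 < T) (hΛ : 0 ≤ Λ) (hη : 0 < η)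
    (hm : m = 2 * Λ + 8 * η) (hc : |G.crossUtility i s₁ - G.crossUtility i s₀| ≤ Λ)
    (x : Fin G.M → Bool) (x' : Bool) {u c : G.Strategy i} (hcu : c = base s₀ s₁ x i ∨ c = u) :
    weight m η T s₀ s₁ i (x i) * G.stepProb m T s₀ s₁ i (x i) (s₂ i) x'
        * G.evalProb T s₀ s₁ i (x i) u ≤
      Real.exp (T * (G.ownUtility i c
        - (experiments s₀ s₁ i (x i) x' : ℝ) * (m - 2 * η - Λ))) := by
  have hm0 : 0 < m := by linarith
  have hw := (weight_pos m η T s₀ s₁ i (x i)).le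
  have hp := stepProb_nonneg (s₀ := s₀) (s₁ := s₁) (i := i) (x := x i) (a := s₂ i) (y := x') hm0 hT
  have he := evalProb_nonneg T s₀ s₁ i (x i) u
  by_cases h0 : G.stepProb m T s₀ s₁ i (x i) (s₂ i) x' = 0
  · rw [h0, mul_zero, zero_mul]; positivity
  by_cases h1 : G.evalProb T s₀ s₁ i (x i) u = 0
  · rw [h1, mul_zero]; positivity
  have hp1 : G.stepProb m T s₀ s₁ i (x i) (s₂ i) x' ≤ Real.exp (T * if x' then -m else 0) := by
    cases x'
    · simpa using stepProb_false_le.trans (evalProb_le_one _ _ _ _ _ _)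
    · exact stepProb_true_le_exp
  cases hx : x i
  · have hb : base s₀ s₁ x i = s₁ i := by simp [base, hx]
    have hu : u = s₁ i := by simpa [hx] using eq_or_eq_of_evalProb_ne_zero h1
    have hc1 : c = s₁ i := by rcases hcu with h | h <;> simp [h, hb, hu]
    have hwb := weight_le_base (m := m) hT hη.le s₀ s₁ x i
    rw [hb] at hwb
    have hstep := mul_le_mul hwb hp1 hp (by positivity)
    rw [← Real.exp_add, ← mul_add] at hstep
    rw [← hx]
    refine (mul_le_of_le_one_right (mul_nonneg hw hp) (evalProb_le_one _ _ _ _ _ _)).trans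
          (hstep.trans (exp_mul_le_exp_mul hT ?_))
    rw [hc1, experiments]
    split_ifs <;> push_cast <;> linarith
  · have hx' : x' = false := by
      cases x'
      · rfl
      · exact absurd (by rw [hx]; exact stepProb_true_true) h0
    subst hx'
    have := weight_mul_evalProb_le (m := m) hT hΛ hη hc hx hcu
    rw [← hx, mul_assoc, mul_comm (G.stepProb _ _ _ _ _ _ _ _), ← mul_assoc]
    refine (mul_le_of_le_one_right (mul_nonneg hw he) (by simpa using hp1)).trans
      (this.trans (exp_mul_le_exp_mul hT ?_))
    simp [experiments, Active, hx]

/-- The strategies reached from the base strategy are adjacent to it. -/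
lemma mem_moves_base_of_ne_zero (h01 : s₁ i ∈ G.moves i (s₀ i)) (x : Fin G.M → Bool)
    {u : G.Strategy i} (h : G.evalProb T s₀ s₁ i (x i) u ≠ 0) :
    u ∈ G.moves i (base s₀ s₁ x i) := by
  unfold base
  rcases eq_or_eq_of_evalProb_ne_zero h with ⟨hx, rfl⟩ | rfl
  · simpa [hx] using G.mem_moves_self i _
  · split_ifs
    · exact h01
    · exact G.mem_moves_self i _

lemma mem_moves_base_of_next_ne_zero (h01 : s₁ i ∈ G.moves i (s₀ i)) (x : Fin G.M → Bool)
    {x' : Bool} {u : G.Strategy i} (h : G.stepProb m T s₀ s₁ i (x i) (s₂ i) x' ≠ 0)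
    (h' : G.evalProb T s₁ s₂ i x' u ≠ 0) : u ∈ G.moves i (base s₀ s₁ x i) := by
  cases x'
  · have h2 : u = s₂ i := by simpa using eq_or_eq_of_evalProb_ne_zero h'
    rw [h2]
    exact mem_moves_base_of_ne_zero (T := T) h01 x fun h0 => h (by simp [stepProb, h0])
  · cases hx : x i
    · have h12 := mem_moves_of_stepProb_ne_zero h01 h
      simp only [base, hx, Bool.false_eq_true, if_false]
      rcases eq_or_eq_of_evalProb_ne_zero h' with ⟨-, rfl⟩ | rfl
      · exact G.mem_moves_self i _
      · exact h12
    · exact absurd (by rw [hx]; exact stepProb_true_true) h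

end Estimates

/-! ### Evaluation without further experiments -/

/-- The probability that the profile is `u` after an evaluation without further experiments. -/
def evalJoint (T : ℝ) (s₀ s₁ : G.Profile) (x : Fin G.M → Bool) (u : G.Profile) : ℝ :=
  ∏ i, G.evalProb T s₀ s₁ i (x i) (u i)

/-- The expectation of `h` after an evaluation without further experiments. -/
def evalMean (T : ℝ) (h : G.Profile → ℝ) (s₀ s₁ : G.Profile) (x : Fin G.M → Bool) : ℝ :=
  ∑ u, evalJoint T s₀ s₁ x u * h u

/-- The flags of an iteration without experiments. -/
def noFlags : Fin G.M → Bool := fun _ => false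

/-- The flags of an iteration in which only UAV `i` experiments. -/
def flag (i : Fin G.M) : Fin G.M → Bool := fun j => decide (j = i)

lemma evalJoint_nonneg (T : ℝ) (s₀ s₁ : G.Profile) (x : Fin G.M → Bool) (u : G.Profile) :
    0 ≤ evalJoint T s₀ s₁ x u := Finset.prod_nonneg fun _ _ => evalProb_nonneg _ _ _ _ _ _

lemma sum_evalJoint (T : ℝ) (s₀ s₁ : G.Profile) (x : Fin G.M → Bool) :
    ∑ u, evalJoint T s₀ s₁ x u = 1 := by
  unfold evalJoint
  rw [sum_prod_apply fun i a => G.evalProb T s₀ s₁ i (x i) a]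
  exact Finset.prod_eq_one fun i _ => sum_evalProb _ _ _ _ _

/-- A sum over profiles of a product whose factors, except one, are supported at one strategy. -/
lemma sum_prod_pinned {ι : Type*} [Fintype ι] [DecidableEq ι] {S : ι → Type*} [∀ i, Fintype (S i)]
    [∀ i, DecidableEq (S i)] (f : ∀ i, S i → ℝ) (s : ∀ i, S i) (i : ι)
    (hf : ∀ j, j ≠ i → ∀ a, a ≠ s j → f j a = 0) (h : (∀ i, S i) → ℝ) :
    ∑ u : ∀ i, S i, (∏ j, f j (u j)) * h u =
      (∏ j ∈ Finset.univ.erase i, f j (s j)) * ∑ a, f i a * h (Function.update s i a) := by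
  rw [Finset.mul_sum]
  refine (Fintype.sum_of_injective (fun a : S i => Function.update s i a)
    (Function.update_injective s i) _ _ (fun u hu => ?_) fun a => ?_).symm
  · have hne : ∃ j, j ≠ i ∧ u j ≠ s j := by
      by_contra! hc
      exact hu ⟨u i, funext fun j => by
        by_cases hj : j = i
        · subst hj; simp
        · simp [hj, hc j hj]⟩
    obtain ⟨j, hj, hu⟩ := hne
    rw [Finset.prod_eq_zero (Finset.mem_univ j) (hf j hj _ hu), zero_mul]
  · rw [← Finset.mul_prod_erase _ _ (Finset.mem_univ i)]
    have hc : ∏ j ∈ Finset.univ.erase i, f j (Function.update s i a j) =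
        ∏ j ∈ Finset.univ.erase i, f j (s j) := Finset.prod_congr rfl fun j hj => by
      rw [Function.update_of_ne (Finset.ne_of_mem_erase hj)]
    rw [hc, Function.update_self]
    ring

lemma evalMean_noFlags (T : ℝ) (h : G.Profile → ℝ) (s₀ s₁ : G.Profile) :
    evalMean T h s₀ s₁ noFlags = h s₁ := by
  unfold evalMean evalJoint
  rw [Finset.sum_eq_single s₁]
  · simp [noFlags, evalProb_false]
  · intro u _ hu
    obtain ⟨i, hi⟩ := Function.ne_iff.1 hu
    rw [Finset.prod_eq_zero (Finset.mem_univ i) (by simp [noFlags, evalProb_false, hi]), zero_mul]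
  · simp

/-- The contribution to the balance of `h` of the iterations from the state `z` with flags `x'`. -/
def increment (m T : ℝ) (h : G.Profile → ℝ) (s₀ s₁ : G.Profile) (x x' : Fin G.M → Bool) : ℝ :=
  ∑ s₂, jointProb m T s₀ s₁ x s₂ x' * (evalMean T h s₁ s₂ x' - evalMean T h s₀ s₁ x)

/-- Tower property: if nobody experiments, the next profile is, up to a constant factor, distributed
as the evaluation of the pending experiments, and nothing is left to decide. This is the reason for
testing with `evalMean`. -/
lemma increment_noFlags (m T : ℝ) (h : G.Profile → ℝ) (s₀ s₁ : G.Profile)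
    (x : Fin G.M → Bool) : increment m T h s₀ s₁ x noFlags = 0 := by
  unfold increment
  have h1 : ∀ s₂, jointProb m T s₀ s₁ x s₂ noFlags =
      (∏ i, if x i then 1 else 1 - omega m T) * evalJoint T s₀ s₁ x s₂ := by
    intro s₂
    unfold jointProb evalJoint
    rw [← Finset.prod_mul_distrib]
    exact Finset.prod_congr rfl fun i _ => by simp [noFlags, stepProb]
  simp only [h1, evalMean_noFlags, mul_assoc, ← Finset.mul_sum, mul_sub,
    Finset.sum_sub_distrib, ← Finset.sum_mul, sum_evalJoint]
  rw [evalMean]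
  ring

/-- Stationarity, tested against the function `evalMean`. -/
lemma sum_increment_eq_zero {m T : ℝ} {ν : G.State → ℝ}
    (hν : IsStationaryDistribution (G.kernel m T) ν) (h : G.Profile → ℝ) :
    ∑ p : G.State × (Fin G.M → Bool),
      ν p.1 * increment m T h p.1.1.1 p.1.1.2.1 p.1.1.2.2 p.2 = 0 := by
  let g : G.State → ℝ := fun z => evalMean T h z.1.1 z.1.2.1 z.1.2.2
  have h1 : ∑ z, ν z * g z = ∑ z, ν z * ∑ z', G.kernel m T z z' * g z' := by
    conv_lhs => rw [← hν.2.2]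
    simp only [Matrix.vecMul, dotProduct, Finset.sum_mul, Finset.mul_sum]
    rw [Finset.sum_comm]
    exact Finset.sum_congr rfl fun _ _ => Finset.sum_congr rfl fun _ _ => mul_assoc _ _ _
  have h2 : ∀ z : G.State, ∑ z', G.kernel m T z z' * g z' =
      ∑ x' : Fin G.M → Bool, ∑ s₂, jointProb m T z.1.1 z.1.2.1 z.1.2.2 s₂ x'
        * evalMean T h z.1.2.1 s₂ x' := by
    intro z
    rw [← sum_kernel_mul m T z fun s₂ x' => evalMean T h z.1.2.1 s₂ x']
    refine Finset.sum_congr rfl fun z' _ => ?_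
    by_cases hz : z'.1.1 = z.1.2.1
    · simp only [g, hz]
    · simp [kernel, hz]
  rw [Fintype.sum_prod_type, ← sub_eq_zero.2 h1.symm, ← Finset.sum_sub_distrib]
  refine Finset.sum_congr rfl fun z _ => ?_
  change ∑ y, ν z * increment m T h z.1.1 z.1.2.1 z.1.2.2 y = _
  rw [← Finset.mul_sum, ← mul_sub, h2]
  congr 1
  simp only [increment, mul_sub, Finset.sum_sub_distrib, ← Finset.sum_mul, sum_jointProb, one_mul]
  rfl

/-! ### Single experiments -/

/-- The number of moves of all UAVs in the profile `s`. -/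
def movesCard (s : G.Profile) : ℝ := ∏ i, ((G.moves i (s i)).card : ℝ)

lemma movesCard_pos (s : G.Profile) : 0 < movesCard s :=
  Finset.prod_pos fun _ _ => card_moves_pos

/-- The conductance between the profiles `s` and `update s i a`. -/
def conductance (T : ℝ) (i : Fin G.M) (s : G.Profile) (a : G.Strategy i) : ℝ :=
  (∏ j ∈ Finset.univ.erase i, ((G.moves j (s j)).card : ℝ)) *
    (Real.exp (T * G.potential s) * Real.exp (T * G.potential (Function.update s i a))
      / (Real.exp (T * G.potential s) + Real.exp (T * G.potential (Function.update s i a))))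

/-- Detailed balance. The product runs over the other UAVs only, so the change of strategy of UAV i
does not affect it. -/
lemma conductance_symm (T : ℝ) (i : Fin G.M) (s : G.Profile) (a : G.Strategy i) :
    conductance T i (Function.update s i a) (s i) = conductance T i s a := by
  unfold conductance
  rw [Finset.prod_congr rfl fun j hj => by
      rw [Function.update_of_ne (Finset.ne_of_mem_erase hj)]]
  simp only [Function.update_idem, Function.update_eq_self]
  rw [add_comm (Real.exp _), mul_comm (Real.exp _)]

/-- Half the harmonic mean of two positive numbers is at least half their minimum, and the counting
factor is at least 1. -/
lemma half_exp_min_le_conductance {T : ℝ} (hT : 0 < T) (i : Fin G.M) (s : G.Profile)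
    (a : G.Strategy i) :
    Real.exp (T * min (G.potential s) (G.potential (Function.update s i a))) / 2
      ≤ conductance T i s a := by
  have key : ∀ u v : ℝ, u ≤ v → Real.exp (T * u) / 2 ≤
      Real.exp (T * u) * Real.exp (T * v) / (Real.exp (T * u) + Real.exp (T * v)) := by
    intro u v huv
    have h1 := exp_mul_le_exp_mul hT huv
    have h2 := Real.exp_pos (T * u)
    have h3 := Real.exp_pos (T * v)
    rw [div_le_div_iff₀ (by norm_num) (by positivity)]
    nlinarith
  have h1 : (1 : ℝ) ≤ ∏ j ∈ Finset.univ.erase i, ((G.moves j (s j)).card : ℝ) := by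
    have := Finset.prod_le_prod (s := Finset.univ.erase i) (f := fun _ => (1 : ℝ))
      (g := fun j => ((G.moves j (s j)).card : ℝ)) (fun _ _ => zero_le_one) fun j _ => by
        exact_mod_cast Finset.card_pos.2 ⟨_, G.mem_moves_self j _⟩
    simpa using this
  unfold conductance
  refine le_trans ?_ (le_mul_of_one_le_left (by positivity) h1)
  rcases le_total (G.potential s) (G.potential (Function.update s i a)) with h | h
  · rw [min_eq_left h]; exact key _ _ h
  · rw [min_eq_right h, add_comm, mul_comm (Real.exp _)]; exact key _ _ h

/-- The ratio of `ν` at the rest state at `s` to the reversible measure of single experiments. -/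
def restRatio (T : ℝ) (ν : G.State → ℝ) (s : G.Profile) : ℝ :=
  ν (G.restState s) / (movesCard s * Real.exp (T * G.potential s))

lemma apply_restState_eq (T : ℝ) (ν : G.State → ℝ) (s : G.Profile) :
    ν (G.restState s) = restRatio T ν s * (movesCard s * Real.exp (T * G.potential s)) := by
  have := movesCard_pos s
  unfold restRatio
  field_simp

/-- The two profiles differ only in the strategy of UAV i, so the logistic choice in U_i is a
logistic choice in the potential. -/
lemma evalMean_flag (T : ℝ) (h : G.Profile → ℝ) (s : G.Profile) (i : Fin G.M)
    (a : G.Strategy i) :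
    evalMean T h s (Function.update s i a) (flag i) - h s =
      Real.exp (T * G.potential (Function.update s i a))
        / (Real.exp (T * G.potential s) + Real.exp (T * G.potential (Function.update s i a)))
        * (h (Function.update s i a) - h s) := by
  have h1 : evalMean T h s (Function.update s i a) (flag i) =
      ∑ b, G.evalProb T s (Function.update s i a) i true b * h (Function.update s i b) := by
    unfold evalMean evalJoint
    rw [sum_prod_pinned (fun j b => G.evalProb T s (Function.update s i a) j (flag i j) b) s i]
    · rw [Finset.prod_eq_one, one_mul]
      · simp [flag]
      · intro j hj
        have hj := Finset.ne_of_mem_erase hj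
        simp [flag, hj, evalProb_false]
    · intro j hj b hb
      simp [flag, hj, evalProb_false, hb]
  by_cases ha : a = s i
  · subst ha
    simp only [Function.update_eq_self, sub_self, mul_zero] at h1 ⊢
    rw [h1, Finset.sum_eq_single (s i)]
    · simp only [Function.update_eq_self, evalProb, if_true]
      rw [← add_div, div_self (by positivity)]
      ring
    · intro b _ hb
      simp [evalProb, hb]
    · simp
  · have hU := G.isPotential_potential i s a
    set s' := Function.update s i a with hs'
    have hs'i : s' i = a := by simp [hs']
    -- The common shift U_i - φ cancels in the quotient.
    have hw : Real.exp (T * G.utility i s') / (Real.exp (T * G.utility i s)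
          + Real.exp (T * G.utility i s')) = Real.exp (T * G.potential s')
        / (Real.exp (T * G.potential s) + Real.exp (T * G.potential s')) := by
      rw [show G.utility i s' = G.utility i s + (G.potential s' - G.potential s) by linarith,
        show T * (G.utility i s + (G.potential s' - G.potential s)) =
          T * G.potential s' + T * (G.utility i s - G.potential s) by ring,
        show T * G.utility i s = T * G.potential s + T * (G.utility i s - G.potential s) by ring,
        Real.exp_add, Real.exp_add, ← add_mul, mul_div_mul_right _ _ (Real.exp_pos _).ne']
    have hsum : Real.exp (T * G.utility i s) / (Real.exp (T * G.utility i s)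
          + Real.exp (T * G.utility i s')) = 1 - Real.exp (T * G.utility i s')
        / (Real.exp (T * G.utility i s) + Real.exp (T * G.utility i s')) := by
      rw [eq_sub_iff_add_eq, ← add_div, div_self (by positivity)]
    rw [h1, ← hw]
    simp only [evalProb, if_true, hs'i, add_mul, Finset.sum_add_distrib, ite_mul, zero_mul,
      Finset.sum_ite_eq', Finset.mem_univ, Function.update_eq_self]
    rw [hsum, ← hs']
    ring

lemma evalMean_restState (T : ℝ) (h : G.Profile → ℝ) (s : G.Profile) :
    evalMean T h s s noFlags = h s := evalMean_noFlags T h s s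

/-- The contribution of single experiments in rest states. -/
lemma mul_increment_flag (m T : ℝ) (ν : G.State → ℝ) (h : G.Profile → ℝ) (s : G.Profile)
    (i : Fin G.M) :
    ν (G.restState s) * increment m T h s s noFlags (flag i) =
      omega m T * (1 - omega m T) ^ (G.M - 1) * ∑ a ∈ G.moves i (s i),
        restRatio T ν s * conductance T i s a * (h (Function.update s i a) - h s) := by
  have h1 : increment m T h s s noFlags (flag i) = (1 - omega m T) ^ (G.M - 1) *
      ∑ a ∈ G.moves i (s i), omega m T / ((G.moves i (s i)).card : ℝ) *
        (evalMean T h s (Function.update s i a) (flag i) - h s) := by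
    unfold increment jointProb
    rw [sum_prod_pinned (fun j a => G.stepProb m T s s j (noFlags j) a (flag i j)) s i]
    · congr 1
      · rw [Finset.prod_congr rfl (g := fun _ => 1 - omega m T), Finset.prod_const,
          Finset.card_erase_of_mem (Finset.mem_univ i), Finset.card_univ, Fintype.card_fin]
        intro j hj
        have hj := Finset.ne_of_mem_erase hj
        simp [flag, noFlags, hj, stepProb, evalProb_false]
      · rw [evalMean_restState]
        simp [flag, noFlags, stepProb, ite_mul, Finset.sum_ite_mem]
    · intro j hj b hb
      simp [flag, noFlags, hj, stepProb, evalProb_false, hb]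
  rw [h1, apply_restState_eq T ν, Finset.mul_sum, Finset.mul_sum, Finset.mul_sum]
  refine Finset.sum_congr rfl fun a _ => ?_
  rw [evalMean_flag]
  have hc : 0 < ((G.moves i (s i)).card : ℝ) := card_moves_pos
  have hM : movesCard s = ((G.moves i (s i)).card : ℝ) *
      ∏ j ∈ Finset.univ.erase i, ((G.moves j (s j)).card : ℝ) :=
    (Finset.mul_prod_erase _ _ (Finset.mem_univ i)).symm
  unfold conductance
  rw [hM]
  field_simp

/-- Reversing an edge, (s, a) ↦ (update s i a, s i), is an involution on the moves. -/
lemma sum_moves_symm (i : Fin G.M) (F : G.Profile → G.Strategy i → ℝ) :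
    ∑ s : G.Profile, ∑ a ∈ G.moves i (s i), F s a =
      ∑ s : G.Profile, ∑ a ∈ G.moves i (s i), F (Function.update s i a) (s i) := by
  rw [Finset.sum_sigma', Finset.sum_sigma']
  refine Finset.sum_nbij' (fun p => ⟨Function.update p.1 i p.2, p.1 i⟩)
    (fun p => ⟨Function.update p.1 i p.2, p.1 i⟩) ?_ ?_ ?_ ?_ ?_
  · rintro ⟨s, a⟩ h
    simpa using G.mem_moves_comm.1 (by simpa using h)
  · rintro ⟨s, a⟩ h
    simpa using G.mem_moves_comm.1 (by simpa using h)
  · rintro ⟨s, a⟩ _; simp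
  · rintro ⟨s, a⟩ _; simp
  · rintro ⟨s, a⟩ _; simp

/-- The contribution of single experiments as a Dirichlet form. -/
lemma sum_mul_increment_flag (m T : ℝ) (ν : G.State → ℝ) (h : G.Profile → ℝ) :
    ∑ q : G.Profile × Fin G.M,
        ν (G.restState q.1) * increment m T h q.1 q.1 noFlags (flag q.2) =
      -(omega m T * (1 - omega m T) ^ (G.M - 1) / 2 * ∑ i, ∑ s : G.Profile,
        ∑ a ∈ G.moves i (s i), conductance T i s a *
          ((restRatio T ν s - restRatio T ν (Function.update s i a))
            * (h s - h (Function.update s i a)))) := by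
  rw [Fintype.sum_prod_type, Finset.sum_comm, Finset.mul_sum, ← Finset.sum_neg_distrib]
  refine Finset.sum_congr rfl fun i _ => ?_
  simp only [mul_increment_flag]
  rw [← Finset.mul_sum]
  -- Symmetrization over both orientations of each edge; this produces the factor 1/2 of the
  -- Dirichlet form.
  have h1 := sum_moves_symm i fun s a =>
    restRatio T ν s * conductance T i s a * (h (Function.update s i a) - h s)
  simp only [Function.update_idem, Function.update_eq_self, conductance_symm] at h1
  have h2 : ∑ s : G.Profile, ∑ a ∈ G.moves i (s i), conductance T i s a *
          ((restRatio T ν s - restRatio T ν (Function.update s i a))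
            * (h s - h (Function.update s i a))) =
      -(∑ s : G.Profile, ∑ a ∈ G.moves i (s i),
          restRatio T ν s * conductance T i s a * (h (Function.update s i a) - h s)
        + ∑ s : G.Profile, ∑ a ∈ G.moves i (s i),
          restRatio T ν (Function.update s i a) * conductance T i s a
            * (h s - h (Function.update s i a))) := by
    simp only [← Finset.sum_add_distrib, ← Finset.sum_neg_distrib]
    exact Finset.sum_congr rfl fun s _ => Finset.sum_congr rfl fun a _ => by ring
  rw [h2, ← h1]
  ring

/-! ### Multiple experiments are negligible -/

/-- If `g` differs at `r` and `u`, then it changes along some unilateral change from `r i` to `u i`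
in the box spanned by `r` and `u`. -/
lemma exists_update_ne {ι : Type*} [Fintype ι] [DecidableEq ι] {S : ι → Type*} {β : Type*}
    {g : (∀ i, S i) → β} {r u : ∀ i, S i} (h : g u ≠ g r) :
    ∃ (c : ∀ i, S i) (i : ι), (∀ j, c j = r j ∨ c j = u j) ∧ c i = r i ∧
      g (Function.update c i (u i)) ≠ g c := by
  by_contra! hc
  have key : ∀ I : Finset ι, g (fun i => if i ∈ I then u i else r i) = g r := by
    intro I
    induction I using Finset.induction_on with
    | empty => simp
    | insert j I hj ih =>
      rw [← ih, ← hc (fun i => if i ∈ I then u i else r i) j (fun i => by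
        split_ifs <;> simp) (by simp [hj])]
      congr 1
      funext i
      by_cases hi : i = j
      · subst hi; simp
      · simp [hi]
  exact h (by simpa using key Finset.univ)

lemma sum_experiments_eq (s₀ s₁ : G.Profile) (x x' : Fin G.M → Bool) :
    ∑ i, experiments s₀ s₁ i (x i) (x' i) =
      (Finset.univ.filter fun i => Active s₀ s₁ i (x i)).card
        + (Finset.univ.filter fun i => x' i = true).card := by
  simp only [experiments, Finset.sum_add_distrib, Finset.card_filter]

lemma eq_restState_of_not_active {z : G.State}
    (h : ∀ i, ¬ Active z.1.1 z.1.2.1 i (z.1.2.2 i)) : z = G.restState z.1.1 := by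
  obtain ⟨⟨s₀, s₁, x⟩, hz⟩ := z
  simp only [Active, not_or, Bool.not_eq_true, not_not] at h
  refine Subtype.ext (Prod.ext rfl (Prod.ext ?_ ?_))
  · exact funext fun i => (h i).2.symm
  · exact funext fun i => (h i).1

/-- Apart from single experiments in rest states, an iteration with an experiment involves at
least two of them. -/
lemma two_le_sum_experiments {z : G.State} {x' : Fin G.M → Bool} (hx : x' ≠ noFlags)
    (h : ∀ s i, (G.restState s, flag i) ≠ (z, x')) :
    2 ≤ ∑ i, experiments z.1.1 z.1.2.1 i (z.1.2.2 i) (x' i) := by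
  rw [sum_experiments_eq]
  obtain ⟨i, hi⟩ := Function.ne_iff.1 hx
  have hi : x' i = true := by simpa [noFlags] using hi
  have hmem : i ∈ Finset.univ.filter fun i => x' i = true := by simp [hi]
  by_cases ha : ∃ j, Active z.1.1 z.1.2.1 j (z.1.2.2 j)
  · obtain ⟨j, hj⟩ := ha
    have h1 : 0 < (Finset.univ.filter fun i => Active z.1.1 z.1.2.1 i (z.1.2.2 i)).card :=
      Finset.card_pos.2 ⟨j, by simpa using hj⟩
    have h2 : 0 < (Finset.univ.filter fun i => x' i = true).card := Finset.card_pos.2 ⟨i, hmem⟩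
    omega
  · push Not at ha
    have hz := eq_restState_of_not_active ha
    have hne : ∃ j, j ≠ i ∧ x' j = true := by
      by_contra! hc
      refine h z.1.1 i (Prod.ext hz.symm (funext fun j => ?_))
      by_cases hj : j = i
      · subst hj; simp [flag, hi]
      · simp [flag, hj, hc j hj]
    obtain ⟨j, hji, hj⟩ := hne
    have := Finset.one_lt_card.2 ⟨i, hmem, j, by simp [hj], hji.symm⟩
    omega

/-! ### Flow across a cut of the set of profiles -/

section Cut

variable {m η Λ T : ℝ}

/-- Since the potential is a sum over UAVs, estimates with a separate strategy `c i` for each UAV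
multiply to an estimate at the profile c. -/
lemma prod_le_exp_potential {f : Fin G.M → ℝ} {c : G.Profile} {q : ℝ} {k : Fin G.M → ℕ}
    (hT : 0 < T) (hq : 0 ≤ q) (hf : ∀ i, 0 ≤ f i)
    (h : ∀ i, f i ≤ Real.exp (T * (G.ownUtility i (c i) - (k i : ℝ) * q)))
    (hk : 2 ≤ ∑ i, k i) : ∏ i, f i ≤ Real.exp (T * (G.potential c - 2 * q)) := by
  refine (Finset.prod_le_prod (fun i _ => hf i) fun i _ => h i).trans ?_
  rw [← Real.exp_sum, ← Finset.mul_sum, Finset.sum_sub_distrib, ← Finset.sum_mul]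
  refine exp_mul_le_exp_mul hT ?_
  have h2 : (2 : ℝ) ≤ ∑ i, (k i : ℝ) := by exact_mod_cast hk
  have := mul_le_mul_of_nonneg_right h2 hq
  unfold potential
  linarith

/-- A flow of size at most `R exp (T (φ c - 2 q))` for all profiles `c` between `r` and `u` is
bounded in terms of the best edge that crosses a cut between `r` and `u`. -/
lemma mul_abs_sub_le_of_cut {h : G.Profile → ℝ} (hh : ∀ s t, |h s - h t| ≤ 1) {K R q Y : ℝ}
    (hT : 0 < T) (hR : 0 ≤ R) (hY : 0 ≤ Y)
    (hK : ∀ s i, ∀ a ∈ G.moves i (s i), h (Function.update s i a) ≠ h s →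
      min (G.potential s) (G.potential (Function.update s i a)) ≤ K)
    {r u : G.Profile} (hru : Y ≠ 0 → ∀ i, u i ∈ G.moves i (r i))
    (hbox : ∀ c : G.Profile, (∀ j, c j = r j ∨ c j = u j) →
      Y ≤ R * Real.exp (T * (G.potential c - 2 * q))) :
    Y * |h u - h r| ≤ R * Real.exp (T * (K - 2 * q)) := by
  by_cases hur : h u = h r
  · rw [hur, sub_self, abs_zero, mul_zero]; positivity
  by_cases hY0 : Y = 0
  · rw [hY0, zero_mul]; positivity
  refine (mul_le_of_le_one_right hY (hh u r)).trans ?_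
  -- An edge of the box that crosses the cut. One of its ends has potential at most K, and the bound
  -- on the flow applies at this end.
  obtain ⟨c, i, hc, hci, hne⟩ := exists_update_ne hur
  have hmin := hK c i (u i) (by rw [hci]; exact hru hY0 i) hne
  have hc' : ∀ j, Function.update c i (u i) j = r j ∨ Function.update c i (u i) j = u j := by
    intro j
    by_cases hj : j = i
    · subst hj; simp
    · simpa [hj] using hc j
  rcases min_le_iff.1 hmin with hle | hle
  · exact (hbox _ hc).trans (mul_le_mul_of_nonneg_left
      (exp_mul_le_exp_mul hT (by linarith)) hR)
  · exact (hbox _ hc').trans (mul_le_mul_of_nonneg_left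
      (exp_mul_le_exp_mul hT (by linarith)) hR)

lemma abs_evalMean_sub_le (T : ℝ) (h : G.Profile → ℝ) (s₀ s₁ r : G.Profile)
    (x : Fin G.M → Bool) : |evalMean T h s₀ s₁ x - h r| ≤
      ∑ u, evalJoint T s₀ s₁ x u * |h u - h r| := by
  have : evalMean T h s₀ s₁ x - h r = ∑ u, evalJoint T s₀ s₁ x u * (h u - h r) := by
    simp only [mul_sub, Finset.sum_sub_distrib, ← Finset.sum_mul, sum_evalJoint, one_mul]
    rfl
  rw [this]
  refine (Finset.abs_sum_le_sum_abs _ _).trans (le_of_eq (Finset.sum_congr rfl fun u _ => ?_))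
  rw [abs_mul, abs_of_nonneg (evalJoint_nonneg _ _ _ _ _)]

/-- The number of profiles. -/
def profileCard (G : UAVNetwork) : ℝ := (Fintype.card G.Profile : ℝ)

/-- The contribution of two or more experiments is bounded in terms of the best edge that crosses
the cut. -/
lemma abs_mul_increment_le {h : G.Profile → ℝ} (hh : ∀ s t, |h s - h t| ≤ 1) {K R : ℝ}
    (hT : 0 < T) (hΛ : 0 ≤ Λ) (hη : 0 < η) (hm : m = 2 * Λ + 8 * η)
    (hcross : ∀ i, G.crossBound i ≤ Λ) (hR : 0 ≤ R)
    (hK : ∀ s i, ∀ a ∈ G.moves i (s i), h (Function.update s i a) ≠ h s →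
      min (G.potential s) (G.potential (Function.update s i a)) ≤ K)
    {ν : G.State → ℝ} {z : G.State} (hν0 : 0 ≤ ν z) (hν : ν z ≤ R * stateWeight m η T z)
    {x' : Fin G.M → Bool}
    (hJ : 2 ≤ ∑ i, experiments z.1.1 z.1.2.1 i (z.1.2.2 i) (x' i)) :
    |ν z * increment m T h z.1.1 z.1.2.1 z.1.2.2 x'| ≤
      2 * G.profileCard ^ 2 * (R * Real.exp (T * (K - 2 * (m - 2 * η - Λ)))) := by
  obtain ⟨⟨s₀, s₁, x⟩, hz⟩ := z
  simp only at hν hJ hz ⊢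
  set w : G.State := ⟨(s₀, s₁, x), hz⟩
  set r := base s₀ s₁ x
  set B := R * Real.exp (T * (K - 2 * (m - 2 * η - Λ)))
  have hB : 0 ≤ B := by positivity
  have hm0 : 0 < m := by linarith
  have hq : 0 ≤ m - 2 * η - Λ := by linarith
  have hc01 : ∀ i, |G.crossUtility i s₁ - G.crossUtility i s₀| ≤ Λ := fun i =>
    (G.abs_crossUtility_sub_le hz i).trans (hcross i)
  have hj : ∀ s₂, 0 ≤ jointProb m T s₀ s₁ x s₂ x' := fun s₂ => jointProb_nonneg hm0 hT
  have hw : ∀ i, 0 ≤ weight m η T s₀ s₁ i (x i) := fun i => (weight_pos _ _ _ _ _ _ _).le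
  have hp : ∀ s₂ : G.Profile, ∀ i, 0 ≤ G.stepProb m T s₀ s₁ i (x i) (s₂ i) (x' i) :=
    fun s₂ i => stepProb_nonneg hm0 hT
  have hfac : ∀ {f : G.Profile → ℝ} {s₂ u c : G.Profile}, 0 ≤ f u →
      stateWeight m η T w * jointProb m T s₀ s₁ x s₂ x' * f u ≤
        Real.exp (T * (G.potential c - 2 * (m - 2 * η - Λ))) →
      ν w * jointProb m T s₀ s₁ x s₂ x' * f u ≤
        R * Real.exp (T * (G.potential c - 2 * (m - 2 * η - Λ))) := by
    intro f s₂ u c hf h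
    have h1 := mul_le_mul_of_nonneg_right hν (mul_nonneg (hj s₂) hf)
    have h2 := mul_le_mul_of_nonneg_left h hR
    linarith
  have hnext : ∀ s₂ u, ν w * jointProb m T s₀ s₁ x s₂ x' * evalJoint T s₁ s₂ x' u * |h u - h r|
      ≤ B := by
    intro s₂ u
    refine mul_abs_sub_le_of_cut hh hT hR (mul_nonneg (mul_nonneg hν0 (hj s₂))
      (evalJoint_nonneg _ _ _ _ _)) hK (fun hne i => ?_) fun c hc => ?_
    · exact mem_moves_base_of_next_ne_zero (hz i) x
        (fun h0 => hne (by rw [jointProb, Finset.prod_eq_zero (Finset.mem_univ i) h0]; ring))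
        (fun h0 => hne (by rw [evalJoint, Finset.prod_eq_zero (Finset.mem_univ i) h0]; ring))
    · refine hfac (evalJoint_nonneg _ _ _ _ _) ?_
      by_cases h0 : jointProb m T s₀ s₁ x s₂ x' = 0
      · rw [h0, mul_zero, zero_mul]; positivity
      have hs₂ : ∀ i, s₂ i ∈ G.moves i (s₁ i) := fun i =>
        mem_moves_of_stepProb_ne_zero (hz i) (Finset.prod_ne_zero_iff.1 h0 i (Finset.mem_univ i))
      have hc12 : ∀ i, |G.crossUtility i s₂ - G.crossUtility i s₁| ≤ Λ := fun i =>
        (G.abs_crossUtility_sub_le hs₂ i).trans (hcross i)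
      rw [stateWeight, jointProb, evalJoint, ← Finset.prod_mul_distrib, ← Finset.prod_mul_distrib]
      exact prod_le_exp_potential hT hq (fun i => mul_nonneg (mul_nonneg (hw i) (hp s₂ i))
        (evalProb_nonneg _ _ _ _ _ _)) (fun i => weight_mul_stepProb_mul_evalProb_next_le
          hT hΛ hη hm (hc01 i) (hc12 i) x (x' i) (hc i)) hJ
  have hstay : ∀ s₂ u, ν w * jointProb m T s₀ s₁ x s₂ x' * evalJoint T s₀ s₁ x u * |h u - h r|
      ≤ B := by
    intro s₂ u
    refine mul_abs_sub_le_of_cut hh hT hR (mul_nonneg (mul_nonneg hν0 (hj s₂))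
      (evalJoint_nonneg _ _ _ _ _)) hK (fun hne i => ?_) fun c hc => ?_
    · exact mem_moves_base_of_ne_zero (hz i) x
        (fun h0 => hne (by rw [evalJoint, Finset.prod_eq_zero (Finset.mem_univ i) h0]; ring))
    · refine hfac (evalJoint_nonneg _ _ _ _ _) ?_
      rw [stateWeight, jointProb, evalJoint, ← Finset.prod_mul_distrib, ← Finset.prod_mul_distrib]
      exact prod_le_exp_potential hT hq (fun i => mul_nonneg (mul_nonneg (hw i) (hp s₂ i))
        (evalProb_nonneg _ _ _ _ _ _)) (fun i => weight_mul_stepProb_mul_evalProb_le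
          hT hΛ hη hm (hc01 i) x (x' i) (hc i)) hJ
  have hterm : ∀ s₂, |ν w * (jointProb m T s₀ s₁ x s₂ x' *
      (evalMean T h s₁ s₂ x' - evalMean T h s₀ s₁ x))| ≤ 2 * G.profileCard * B := by
    intro s₂
    -- Both means are compared with h at the base profile r. The constant 2 N², with N the number of
    -- profiles, counts the two means, the profiles s₂ and the outcomes u.
    have hd : |evalMean T h s₁ s₂ x' - evalMean T h s₀ s₁ x| ≤
        ∑ u, evalJoint T s₁ s₂ x' u * |h u - h r| + ∑ u, evalJoint T s₀ s₁ x u * |h u - h r| := by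
      have h1 := abs_evalMean_sub_le T h s₁ s₂ r x'
      have h2 := abs_evalMean_sub_le T h s₀ s₁ r x
      have h3 := abs_sub_le (evalMean T h s₁ s₂ x') (h r) (evalMean T h s₀ s₁ x)
      rw [abs_sub_comm (h r)] at h3
      linarith
    have hνj : 0 ≤ ν w * jointProb m T s₀ s₁ x s₂ x' := mul_nonneg hν0 (hj s₂)
    rw [← mul_assoc, abs_mul, abs_of_nonneg hνj]
    refine (mul_le_mul_of_nonneg_left hd hνj).trans ?_
    rw [mul_add, Finset.mul_sum, Finset.mul_sum]
    have h1 := Finset.sum_le_card_nsmul (Finset.univ : Finset G.Profile) _ B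
      fun u _ => hnext s₂ u
    have h2 := Finset.sum_le_card_nsmul (Finset.univ : Finset G.Profile) _ B
      fun u _ => hstay s₂ u
    rw [nsmul_eq_mul, Finset.card_univ] at h1 h2
    simp only [mul_assoc] at h1 h2 ⊢
    unfold profileCard
    linarith
  unfold increment
  rw [Finset.mul_sum]
  refine (Finset.abs_sum_le_sum_abs _ _).trans ?_
  refine (Finset.sum_le_card_nsmul (Finset.univ : Finset G.Profile) _ _
    fun s₂ _ => hterm s₂).trans (le_of_eq ?_)
  rw [nsmul_eq_mul, Finset.card_univ]
  unfold profileCard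
  ring

/-- The number of pairs of a state and flags. -/
def transitionCard (G : UAVNetwork) : ℝ := (Fintype.card (G.State × (Fin G.M → Bool)) : ℝ)

/-- In the balance equation the terms without experiments vanish and those with at least two are
bounded, so the single experiments at rest, which make up the rest, obey the same bound. -/
lemma abs_sum_single_le {h : G.Profile → ℝ} (hh : ∀ s t, |h s - h t| ≤ 1) {K R : ℝ}
    (hT : 0 < T) (hΛ : 0 ≤ Λ) (hη : 0 < η) (hm : m = 2 * Λ + 8 * η)
    (hcross : ∀ i, G.crossBound i ≤ Λ) (hR : 0 ≤ R)
    (hK : ∀ s i, ∀ a ∈ G.moves i (s i), h (Function.update s i a) ≠ h s →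
      min (G.potential s) (G.potential (Function.update s i a)) ≤ K)
    {ν : G.State → ℝ} (hst : IsStationaryDistribution (G.kernel m T) ν)
    (hν : ∀ z, ν z ≤ R * stateWeight m η T z) :
    |∑ q : G.Profile × Fin G.M,
        ν (G.restState q.1) * increment m T h q.1 q.1 noFlags (flag q.2)| ≤
      G.transitionCard *
        (2 * G.profileCard ^ 2 * (R * Real.exp (T * (K - 2 * (m - 2 * η - Λ))))) := by
  set B := 2 * G.profileCard ^ 2 * (R * Real.exp (T * (K - 2 * (m - 2 * η - Λ))))
  have hB : 0 ≤ B := by unfold B profileCard; positivity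
  let t : G.State × (Fin G.M → Bool) → ℝ := fun p =>
    ν p.1 * increment m T h p.1.1.1 p.1.1.2.1 p.1.1.2.2 p.2
  let e : G.Profile × Fin G.M → G.State × (Fin G.M → Bool) := fun q =>
    (G.restState q.1, flag q.2)
  have he : Function.Injective e := by
    rintro ⟨s, i⟩ ⟨s', i'⟩ heq
    have h1 : s = s' := congrArg (fun p => p.1.1.1) heq
    have h2 := congrFun (congrArg Prod.snd heq) i
    have h3 : i = i' := by simpa [e, flag] using h2
    rw [h1, h3]
  have htot : ∑ p, t p = 0 := sum_increment_eq_zero hst h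
  have hmain : ∑ q : G.Profile × Fin G.M,
        ν (G.restState q.1) * increment m T h q.1 q.1 noFlags (flag q.2)
      = ∑ p ∈ Finset.univ.image e, t p := by
    rw [Finset.sum_image fun a _ b _ hab => he hab]
    rfl
  have hsplit := Finset.sum_add_sum_compl (Finset.univ.image e) t
  rw [htot] at hsplit
  rw [hmain, eq_neg_of_add_eq_zero_left hsplit, abs_neg]
  refine (Finset.abs_sum_le_sum_abs _ _).trans ?_
  have hle : ∀ p ∈ (Finset.univ.image e)ᶜ, |t p| ≤ B := by
    rintro ⟨z, x'⟩ hp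
    by_cases hx : x' = noFlags
    · simpa [t, hx, increment_noFlags] using hB
    · refine abs_mul_increment_le hh hT hΛ hη hm hcross hR hK (hst.1 z) (hν z)
        (two_le_sum_experiments hx fun s i heq => ?_)
      simp only [Finset.mem_compl, Finset.mem_image, Finset.mem_univ, true_and, not_exists] at hp
      exact hp (s, i) heq
  refine (Finset.sum_le_card_nsmul _ _ _ hle).trans ?_
  rw [nsmul_eq_mul]
  refine mul_le_mul_of_nonneg_right ?_ hB
  unfold transitionCard
  exact_mod_cast Finset.card_le_univ _

/-- The constant in the bound on the gaps between the values of `restRatio`. -/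
def gapConstant (G : UAVNetwork) : ℝ :=
  8 * 2 ^ (G.M - 1) * G.transitionCard * G.profileCard ^ 2

/-- The values of `restRatio` have no large gap. -/
lemma exists_restRatio_le_add (hT : 0 < T) (hΛ : 0 ≤ Λ) (hη : 0 < η) (hm : m = 2 * Λ + 8 * η)
    (hcross : ∀ i, G.crossBound i ≤ Λ) {R : ℝ} (hR : 0 ≤ R) (hω : omega m T ≤ 1 / 2)
    {ν : G.State → ℝ} (hst : IsStationaryDistribution (G.kernel m T) ν)
    (hν : ∀ z, ν z ≤ R * stateWeight m η T z) {t : ℝ}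
    (h1 : ∃ s, t < restRatio T ν s) (h2 : ∃ s, restRatio T ν s ≤ t) :
    ∃ s s', t < restRatio T ν s ∧ restRatio T ν s' ≤ t ∧
      restRatio T ν s ≤ restRatio T ν s' + G.gapConstant * R * Real.exp (-(T * (4 * η))) := by
  set ρ := restRatio T ν
  -- The indicator of a superlevel set of ρ is monotone in ρ, so every term of the Dirichlet form is
  -- nonnegative and one crossing edge can be singled out.
  let h : G.Profile → ℝ := fun s => if t < ρ s then 1 else 0
  have hh : ∀ s t, |h s - h t| ≤ 1 := by
    intro s t
    simp only [h]
    split_ifs <;> norm_num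
  let E : Finset (Σ i, G.Profile × G.Strategy i) := Finset.univ.filter fun p =>
    p.2.2 ∈ G.moves p.1 (p.2.1 p.1) ∧ h (Function.update p.2.1 p.1 p.2.2) ≠ h p.2.1
  have hE : E.Nonempty := by
    by_contra hne
    rw [Finset.not_nonempty_iff_eq_empty, Finset.filter_eq_empty_iff] at hne
    obtain ⟨s, hs⟩ := h1
    obtain ⟨s', hs'⟩ := h2
    have := G.eq_of_update_moves_eq (g := h) (fun s i a ha => by
      have := hne (Finset.mem_univ ⟨i, s, a⟩)
      simp only [not_and, not_not] at this
      exact this ha) s s'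
    simp [h, hs, not_lt.2 hs'] at this
  -- The crossing edge with the largest minimum of the potential has, up to constants, the largest
  -- conductance, and it controls all crossing flows of multiple experiments.
  obtain ⟨⟨i, s, a⟩, hp, hmax⟩ := Finset.exists_max_image E
    (fun p => min (G.potential p.2.1) (G.potential (Function.update p.2.1 p.1 p.2.2))) hE
  obtain ⟨ha, hne⟩ : a ∈ G.moves i (s i) ∧ h (Function.update s i a) ≠ h s := by
    simpa [E] using hp
  set K := min (G.potential s) (G.potential (Function.update s i a)) with hKdef
  have hbound := abs_sum_single_le hh hT hΛ hη hm hcross hR (K := K)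
    (fun s' i' a' ha' hne' => hmax ⟨i', s', a'⟩ (by simpa [E] using ⟨ha', hne'⟩)) hst hν
  rw [sum_mul_increment_flag, abs_neg] at hbound
  have hterm : ∀ i' s' a', 0 ≤ conductance T i' s' a' *
      ((ρ s' - ρ (Function.update s' i' a')) * (h s' - h (Function.update s' i' a'))) := by
    intro i' s' a'
    refine mul_nonneg ((by positivity : (0 : ℝ) ≤ _).trans
      (half_exp_min_le_conductance hT i' s' a')) ?_
    simp only [h]
    split_ifs <;> nlinarith
  have hsum : conductance T i s a *
      ((ρ s - ρ (Function.update s i a)) * (h s - h (Function.update s i a))) ≤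
      ∑ i, ∑ s : G.Profile, ∑ a ∈ G.moves i (s i), conductance T i s a *
          ((ρ s - ρ (Function.update s i a)) * (h s - h (Function.update s i a))) := by
    refine le_trans ?_ (Finset.single_le_sum (fun i' _ => Finset.sum_nonneg fun s' _ =>
      Finset.sum_nonneg fun a' _ => hterm i' s' a') (Finset.mem_univ i))
    refine le_trans ?_ (Finset.single_le_sum (fun s' _ =>
      Finset.sum_nonneg fun a' _ => hterm i s' a') (Finset.mem_univ s))
    exact Finset.single_le_sum (f := fun a => conductance T i s a *
      ((ρ s - ρ (Function.update s i a)) * (h s - h (Function.update s i a))))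
      (fun a' _ => hterm i s a') ha
  have habs : (ρ s - ρ (Function.update s i a)) * (h s - h (Function.update s i a)) =
      |ρ s - ρ (Function.update s i a)| := by
    simp only [h] at hne ⊢
    split_ifs at hne ⊢ with c1 c2
    · exact absurd rfl hne
    · rw [sub_zero, mul_one, abs_of_nonneg]; linarith
    · rw [abs_of_nonpos (by linarith)]; ring
    · exact absurd rfl hne
  rw [habs] at hsum
  have hgap : |ρ s - ρ (Function.update s i a)| ≤
      G.gapConstant * R * Real.exp (-(T * (4 * η))) := by
    set d := |ρ s - ρ (Function.update s i a)|
    have hd : 0 ≤ d := abs_nonneg _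
    set P : ℝ := 2 ^ (G.M - 1) with hPdef
    have hP : 0 < P := by positivity
    have hω0 := omega_pos m T
    have hpow : 1 / P ≤ (1 - omega m T) ^ (G.M - 1) := by
      have := pow_le_pow_left₀ (by norm_num : (0 : ℝ) ≤ 1 / 2)
        (by linarith : (1 : ℝ) / 2 ≤ 1 - omega m T) (G.M - 1)
      rwa [one_div_pow] at this
    have hc := (mul_le_mul_of_nonneg_right (half_exp_min_le_conductance hT i s a) hd).trans hsum
    have hcoef : omega m T * (1 / P) / 2 ≤ omega m T * (1 - omega m T) ^ (G.M - 1) / 2 := by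
      gcongr
    have hfin := (mul_le_mul hcoef hc (by positivity)
      ((by positivity : (0 : ℝ) ≤ _).trans hcoef)).trans ((le_abs_self _).trans hbound)
    -- Two experiments cost 2(m - 2η - Λ) = m + 4η. The condition m > 2Λ is used here: the surplus
    -- over the cost m of a single experiment is 4η > 0.
    have hexp : Real.exp (T * (K - 2 * (m - 2 * η - Λ))) =
        omega m T * Real.exp (T * K) * Real.exp (-(T * (4 * η))) := by
      unfold omega
      rw [← Real.exp_add, ← Real.exp_add, hm]
      congr 1
      ring
    rw [← hKdef, hexp] at hfin
    have hpos : 0 < omega m T * Real.exp (T * K) / (4 * P) := by positivity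
    refine le_of_mul_le_mul_left (le_trans (le_of_eq ?_) (hfin.trans (le_of_eq ?_))) hpos
    · field_simp
      ring
    · unfold gapConstant
      rw [← hPdef]
      field_simp
      ring
  simp only [h] at hne
  split_ifs at hne with c1 c2 c2
  · exact absurd rfl hne
  · refine ⟨_, s, c1, not_lt.1 c2, ?_⟩
    have := neg_abs_le (ρ s - ρ (Function.update s i a))
    linarith
  · refine ⟨s, _, c2, not_lt.1 c1, ?_⟩
    have := le_abs_self (ρ s - ρ (Function.update s i a))
    linarith
  · exact absurd rfl hne

/-- A function on a finite type whose values have no gap larger than `δ` varies little. -/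
lemma le_add_card_mul_of_no_gap {S : Type*} [Fintype S] {ρ : S → ℝ} {δ : ℝ}
    (h : ∀ t, (∃ s, t < ρ s) → (∃ s, ρ s ≤ t) →
      ∃ s s', t < ρ s ∧ ρ s' ≤ t ∧ ρ s ≤ ρ s' + δ) (hδ : 0 ≤ δ) (s s' : S) :
    ρ s ≤ ρ s' + Fintype.card S * δ := by
  -- Raising the threshold by δ either captures a new point, since there is no gap, or all points
  -- are already below it. For k = card S the count k + 1 is impossible.
  have key : ∀ k : ℕ, (∀ u, ρ u ≤ ρ s' + k * δ) ∨
      k + 1 ≤ (Finset.univ.filter fun u => ρ u ≤ ρ s' + k * δ).card := by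
    intro k
    induction k with
    | zero =>
      right
      exact Finset.card_pos.2 ⟨s', by simp⟩
    | succ k ih =>
      by_cases hall : ∀ u, ρ u ≤ ρ s' + k * δ
      · left
        intro u
        have := hall u
        push_cast
        linarith
      · have hcard := ih.resolve_left hall
        push Not at hall
        obtain ⟨u, v, hu, hv, huv⟩ := h _ hall ⟨s', le_add_of_nonneg_right (by positivity)⟩
        right
        have hss : (Finset.univ.filter fun u => ρ u ≤ ρ s' + k * δ) ⊂
            Finset.univ.filter fun u => ρ u ≤ ρ s' + ((k + 1 : ℕ) : ℝ) * δ := by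
          rw [Finset.ssubset_iff_of_subset]
          · refine ⟨u, ?_, by simpa using hu⟩
            simp only [Finset.mem_filter, Finset.mem_univ, true_and]
            push_cast
            linarith
          · intro w hw
            simp only [Finset.mem_filter, Finset.mem_univ, true_and] at hw ⊢
            push_cast
            linarith
        have := Finset.card_lt_card hss
        omega
  rcases key (Fintype.card S) with h1 | h1
  · exact h1 s
  · have := Finset.card_le_univ (Finset.univ.filter fun u => ρ u ≤ ρ s' + Fintype.card S * δ)
    omega

end Cut

/-! ### The limit of the stationary distribution -/

section Limit

variable {m η Λ T : ℝ}

lemma stateWeight_restState (m η T : ℝ) (s : G.Profile) :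
    stateWeight m η T (G.restState s) = Real.exp (T * G.potential s) := by
  simp only [stateWeight, weight, restState, Bool.false_eq_true, if_false, if_true]
  rw [← Real.exp_sum, ← Finset.mul_sum, potential]

lemma stateWeight_le (hT : 0 < T) (hΛ : 0 ≤ Λ) (hη : 0 < η) (hm : m = 2 * Λ + 8 * η)
    (z : G.State) : stateWeight m η T z ≤
      Real.exp (T * G.potential (base z.1.1 z.1.2.1 z.1.2.2)) := by
  rw [potential, Finset.mul_sum, Real.exp_sum]
  refine Finset.prod_le_prod (fun i _ => (weight_pos _ _ _ _ _ _ _).le) fun i _ => ?_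
  refine (weight_le_base hT hη.le _ _ _ _).trans (exp_mul_le_exp_mul hT ?_)
  split_ifs <;> linarith

lemma exists_active_of_ne_restState {z : G.State} (hz : ∀ s, z ≠ G.restState s) :
    ∃ i, Active z.1.1 z.1.2.1 i (z.1.2.2 i) := by
  by_contra! h
  exact hz _ (eq_restState_of_not_active h)

/-- A state that is not a rest state has an active UAV, and one spare factor e^{-Tη} survives in the
product of the estimates for single UAVs. -/
lemma stateWeight_mul_kernel_le (hT : 0 < T) (hΛ : 0 ≤ Λ) (hη : 0 < η) (hm : m = 2 * Λ + 8 * η)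
    (hcross : ∀ i, G.crossBound i ≤ Λ) (y : G.State) {z : G.State}
    (hz : ∀ s, z ≠ G.restState s) :
    stateWeight m η T y * G.kernel m T y z ≤ Real.exp (T * -η) * stateWeight m η T z := by
  have hw := stateWeight_pos m η T z
  by_cases hyz : z.1.1 = y.1.2.1
  · simp only [kernel, Matrix.of_apply, hyz, if_true]
    rw [stateWeight, ← Finset.prod_mul_distrib]
    have hm0 : 0 < m := by linarith
    refine (Finset.prod_le_prod (fun i _ => mul_nonneg (weight_pos _ _ _ _ _ _ _).le
      (stepProb_nonneg hm0 hT)) fun i _ => weight_mul_stepProb_le hT hΛ hη hm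
      ((G.abs_crossUtility_sub_le y.2 i).trans (hcross i)) _ _).trans ?_
    rw [Finset.prod_mul_distrib, ← hyz, mul_comm]
    refine mul_le_mul_of_nonneg_right ?_ hw.le
    obtain ⟨i, hi⟩ := exists_active_of_ne_restState hz
    have h1 : Real.exp (T * -η) ≤ 1 := Real.exp_le_one_iff.2 (by nlinarith)
    rw [← Finset.mul_prod_erase _ _ (Finset.mem_univ i), if_pos hi]
    refine mul_le_of_le_one_right (Real.exp_pos _).le (Finset.prod_le_one (fun j _ => ?_)
      fun j _ => ?_) <;> split_ifs <;> first | positivity | exact h1 | exact le_rfl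
  · simp only [kernel, Matrix.of_apply, hyz, if_false, mul_zero]
    positivity

/-- The number of states. -/
def stateCard (G : UAVNetwork) : ℝ := (Fintype.card G.State : ℝ)

/-- For small noise, the ratio of the stationary distribution to the weight is maximal at a rest
state, and small at the other states. -/
lemma exists_restState_max (hT : 0 < T) (hΛ : 0 ≤ Λ) (hη : 0 < η) (hm : m = 2 * Λ + 8 * η)
    (hcross : ∀ i, G.crossBound i ≤ Λ) (hsmall : G.stateCard * Real.exp (T * -η) < 1)
    {ν : G.State → ℝ} (hst : IsStationaryDistribution (G.kernel m T) ν) :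
    ∃ s, 0 < ν (G.restState s) ∧
      (∀ z, ν z ≤ ν (G.restState s) / Real.exp (T * G.potential s) * stateWeight m η T z) ∧
      ∀ z, (∀ s', z ≠ G.restState s') → ν z ≤ G.stateCard * Real.exp (T * -η) *
        (ν (G.restState s) / Real.exp (T * G.potential s)) * stateWeight m η T z := by
  obtain ⟨z₀, -, hz₀⟩ := Finset.exists_max_image Finset.univ
    (fun z => ν z / stateWeight m η T z) Finset.univ_nonempty
  set R := ν z₀ / stateWeight m η T z₀ with hRdef
  have hle : ∀ z, ν z ≤ R * stateWeight m η T z := fun z =>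
    (div_le_iff₀ (stateWeight_pos m η T z)).1 (hz₀ z (Finset.mem_univ z))
  have hR0 : 0 ≤ R := div_nonneg (hst.1 z₀) (stateWeight_pos m η T z₀).le
  have hR : 0 < R := by
    refine hR0.lt_of_ne fun h => ?_
    have h0 : ∑ z, ν z ≤ 0 := Finset.sum_nonpos fun z _ => by simpa [← h] using hle z
    rw [hst.2.1] at h0
    linarith
  -- Apply stationarity once and bound each summand by the maximal ratio R. If R were attained off
  -- the rest states, this would contradict `hsmall`.
  have hact : ∀ z, (∀ s', z ≠ G.restState s') →
      ν z ≤ G.stateCard * Real.exp (T * -η) * R * stateWeight m η T z := by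
    intro z hz
    conv_lhs => rw [← hst.2.2]
    simp only [Matrix.vecMul, dotProduct]
    have hterm : ∀ y ∈ (Finset.univ : Finset G.State), ν y * G.kernel m T y z ≤
        R * (Real.exp (T * -η) * stateWeight m η T z) := by
      intro y _
      have h1 := mul_le_mul_of_nonneg_right (hle y)
        (kernel_nonneg (m := m) (by linarith) hT y z)
      have h2 := mul_le_mul_of_nonneg_left
        (stateWeight_mul_kernel_le hT hΛ hη hm hcross y hz) hR0
      linarith
    refine (Finset.sum_le_card_nsmul _ _ _ hterm).trans (le_of_eq ?_)
    rw [nsmul_eq_mul, Finset.card_univ]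
    unfold stateCard
    ring
  have hrest : ∃ s, z₀ = G.restState s := by
    by_contra! hne
    have h1 := hact z₀ hne
    have hw := stateWeight_pos m η T z₀
    have h2 : ν z₀ = R * stateWeight m η T z₀ := by rw [hRdef]; field_simp
    have h3 := mul_lt_mul_of_pos_right hsmall (mul_pos hR hw)
    linarith
  obtain ⟨s, rfl⟩ := hrest
  rw [stateWeight_restState] at hRdef
  refine ⟨s, ?_, by rwa [← hRdef], by rwa [← hRdef]⟩
  have : ν (G.restState s) = R * Real.exp (T * G.potential s) := by
    rw [hRdef]; field_simp
  rw [this]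
  positivity

lemma movesCard_le (s : G.Profile) : movesCard s ≤ G.profileCard := by
  unfold movesCard profileCard
  rw [Fintype.card_pi]
  push_cast
  refine Finset.prod_le_prod (fun i _ => Nat.cast_nonneg _) fun i _ => ?_
  exact_mod_cast Finset.card_le_univ _

lemma profileCard_pos : 0 < G.profileCard := by
  unfold profileCard
  exact_mod_cast Fintype.card_pos

/-- For small noise, the stationary distribution is close to a multiple of an explicit measure on
the rest states. -/
lemma exists_scale (hT : 0 < T) (hΛ : 0 ≤ Λ) (hη : 0 < η) (hm : m = 2 * Λ + 8 * η)
    (hcross : ∀ i, G.crossBound i ≤ Λ) (hsmall : G.stateCard * Real.exp (T * -η) < 1)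
    (hω : omega m T ≤ 1 / 2) {ν : G.State → ℝ}
    (hst : IsStationaryDistribution (G.kernel m T) ν) {s₀ : G.Profile}
    (hs₀ : IsMaximizer G.potential s₀) :
    ∃ X > 0, (∀ s, |ν (G.restState s) / X
        - movesCard s * Real.exp (-(T * (G.potential s₀ - G.potential s)))| ≤
          G.profileCard ^ 3 * G.gapConstant * Real.exp (T * -η)) ∧
      ∀ z, (∀ s, z ≠ G.restState s) →
        |ν z / X| ≤ G.stateCard * G.profileCard * Real.exp (T * -η) := by
  obtain ⟨s₁, hpos, hle, hact⟩ := exists_restState_max hT hΛ hη hm hcross hsmall hst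
  set R := ν (G.restState s₁) / Real.exp (T * G.potential s₁) with hRdef
  have hR : 0 < R := by positivity
  obtain ⟨s₂, -, hs₂⟩ := Finset.exists_max_image Finset.univ (restRatio T ν)
    Finset.univ_nonempty
  set r := restRatio T ν s₂
  have hn := profileCard_pos (G := G)
  -- At s₁ the ratio to the weight is ρ times the number of joint moves, which is at most the number
  -- of profiles. Bounds relative to R thus become bounds relative to max ρ.
  have hRr : R ≤ G.profileCard * r := by
    have h1 : R = restRatio T ν s₁ * movesCard s₁ := by
      have := movesCard_pos s₁
      rw [hRdef, restRatio]
      field_simp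
    rw [h1, mul_comm]
    refine mul_le_mul (movesCard_le s₁) (hs₂ s₁ (Finset.mem_univ _)) ?_ hn.le
    exact div_nonneg hpos.le (mul_nonneg (movesCard_pos s₁).le (Real.exp_pos _).le)
  have hr : 0 < r := pos_of_mul_pos_right (hR.trans_le hRr) hn.le
  have hC : 0 ≤ G.gapConstant := by unfold gapConstant transitionCard profileCard; positivity
  -- The scale is max ρ times e^{T max φ}, so the comparison measure stays bounded and converges as
  -- T → ∞.
  refine ⟨r * Real.exp (T * G.potential s₀), by positivity, fun s => ?_, fun z hz => ?_⟩
  · have hclose := le_add_card_mul_of_no_gap (fun t h1 h2 =>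
      exists_restRatio_le_add hT hΛ hη hm hcross hR.le hω hst hle h1 h2)
      (by positivity) s₂ s
    have hup : restRatio T ν s ≤ r := hs₂ s (Finset.mem_univ s)
    have hexp : Real.exp (-(T * (4 * η))) ≤ Real.exp (T * -η) :=
      Real.exp_le_exp.2 (by nlinarith [mul_pos hT hη])
    have hdiff : |restRatio T ν s / r - 1| ≤
        G.profileCard ^ 2 * G.gapConstant * Real.exp (T * -η) := by
      rw [div_sub_one hr.ne', abs_div, abs_of_pos hr, div_le_iff₀ hr, abs_sub_comm,
        abs_of_nonneg (by linarith)]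
      have h1 : G.gapConstant * R * Real.exp (-(T * (4 * η))) ≤
          G.gapConstant * (G.profileCard * r) * Real.exp (T * -η) := by gcongr
      have h2 := mul_le_mul_of_nonneg_left h1 hn.le
      unfold profileCard at h2 ⊢
      linarith
    have hM := movesCard_pos s
    have e : ν (G.restState s) / (r * Real.exp (T * G.potential s₀))
        - movesCard s * Real.exp (-(T * (G.potential s₀ - G.potential s))) =
        (restRatio T ν s / r - 1) *
          (movesCard s * Real.exp (-(T * (G.potential s₀ - G.potential s)))) := by
      rw [apply_restState_eq T ν s, show -(T * (G.potential s₀ - G.potential s)) =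
        T * G.potential s - T * G.potential s₀ by ring, Real.exp_sub]
      field_simp
    have hle1 : Real.exp (-(T * (G.potential s₀ - G.potential s))) ≤ 1 :=
      Real.exp_le_one_iff.2 (by nlinarith [hs₀ s])
    rw [e, abs_mul, abs_of_nonneg (by positivity : 0 ≤ movesCard s *
      Real.exp (-(T * (G.potential s₀ - G.potential s))))]
    refine (mul_le_mul hdiff ((mul_le_of_le_one_right hM.le hle1).trans (movesCard_le s))
      (by positivity) (by positivity)).trans (le_of_eq (by ring))
  · rw [abs_of_nonneg (div_nonneg (hst.1 z) (by positivity)), div_le_iff₀ (by positivity)]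
    have hS : 0 ≤ G.stateCard := by unfold stateCard; positivity
    refine (hact z hz).trans ?_
    have h1 : stateWeight m η T z ≤ Real.exp (T * G.potential s₀) :=
      (stateWeight_le hT hΛ hη hm z).trans (exp_mul_le_exp_mul hT (hs₀ _))
    calc G.stateCard * Real.exp (T * -η) * R * stateWeight m η T z
        ≤ G.stateCard * Real.exp (T * -η) * (G.profileCard * r)
          * Real.exp (T * G.potential s₀) := by
          have := (stateWeight_pos m η T z).le
          gcongr
      _ = _ := by ring

open Classical in
/-- The limit of the stationary distribution, up to normalization. -/
def limitWeight (z : G.State) : ℝ :=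
  if ∃ s, z = G.restState s ∧ IsMaximizer G.potential s then movesCard z.1.1 else 0

lemma exists_isMaximizer (G : UAVNetwork) : ∃ s, IsMaximizer G.potential s := by
  obtain ⟨s, -, hs⟩ := Finset.exists_max_image Finset.univ G.potential Finset.univ_nonempty
  exact ⟨s, fun t => hs t (Finset.mem_univ t)⟩

lemma limitWeight_nonneg (z : G.State) : 0 ≤ limitWeight z := by
  unfold limitWeight
  split_ifs
  · exact (movesCard_pos _).le
  · exact le_rfl

lemma limitWeight_pos_iff (z : G.State) :
    0 < limitWeight z ↔ ∃ s, z = G.restState s ∧ IsMaximizer G.potential s := by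
  unfold limitWeight
  split_ifs with h
  · exact ⟨fun _ => h, fun _ => movesCard_pos _⟩
  · exact ⟨fun h0 => absurd h0 (lt_irrefl 0), fun h1 => absurd h1 h⟩

lemma sum_limitWeight_pos (G : UAVNetwork) : 0 < ∑ z : G.State, limitWeight z := by
  obtain ⟨s, hs⟩ := exists_isMaximizer G
  exact Finset.sum_pos' (fun z _ => limitWeight_nonneg z)
    ⟨G.restState s, Finset.mem_univ _, (limitWeight_pos_iff _).2 ⟨s, rfl, hs⟩⟩

/-- The stationary distributions converge as the noise vanishes. -/
lemma tendsto_stationaryDistribution (hΛ : 0 ≤ Λ) (hη : 0 < η) (hm : m = 2 * Λ + 8 * η)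
    (hcross : ∀ i, G.crossBound i ≤ Λ) {ν : ℝ → G.State → ℝ}
    (hν : ∀ T > 0, IsStationaryDistribution (G.kernel m T) (ν T)) (z : G.State) :
    Tendsto (fun T => ν T z) atTop (𝓝 (limitWeight z / ∑ z : G.State, limitWeight z)) := by
  obtain ⟨s₀, hs₀⟩ := exists_isMaximizer G
  have hη0 : Tendsto (fun T : ℝ => Real.exp (T * -η)) atTop (𝓝 0) := by
    simpa only [mul_neg] using tendsto_exp_mul_neg hη
  have hm0 : 0 < m := by linarith
  have hev : ∀ᶠ T in atTop, 0 < T ∧ G.stateCard * Real.exp (T * -η) < 1 ∧ omega m T ≤ 1 / 2 := by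
    refine (eventually_gt_atTop 0).and (Eventually.and ?_ ?_)
    · have := hη0.const_mul G.stateCard
      rw [mul_zero] at this
      exact this.eventually_lt_const one_pos
    · exact ((tendsto_exp_mul_neg hm0).eventually_lt_const (by norm_num : (0 : ℝ) < 1 / 2)).mono
        fun T h => h.le
  have hX : ∀ T, ∃ X : ℝ, 0 < T ∧ G.stateCard * Real.exp (T * -η) < 1 ∧ omega m T ≤ 1 / 2 →
      0 < X ∧ (∀ s, |ν T (G.restState s) / X
        - movesCard s * Real.exp (-(T * (G.potential s₀ - G.potential s)))| ≤
          G.profileCard ^ 3 * G.gapConstant * Real.exp (T * -η)) ∧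
      ∀ z, (∀ s, z ≠ G.restState s) →
        |ν T z / X| ≤ G.stateCard * G.profileCard * Real.exp (T * -η) := by
    intro T
    by_cases h : 0 < T ∧ G.stateCard * Real.exp (T * -η) < 1 ∧ omega m T ≤ 1 / 2
    · obtain ⟨X, h1, h2⟩ := exists_scale h.1 hΛ hη hm hcross h.2.1 h.2.2 (hν T h.1) hs₀
      exact ⟨X, fun _ => ⟨h1, h2⟩⟩
    -- A dummy scale for the values of T that are not yet large.
    · exact ⟨1, fun h' => absurd h' h⟩
  choose X hX using hX
  have hlim : ∀ z, Tendsto (fun T => ν T z / X T) atTop (𝓝 (limitWeight z)) := by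
    intro z
    by_cases hz : ∃ s, z = G.restState s
    · obtain ⟨s, rfl⟩ := hz
      have h1 : Tendsto (fun T => ν T (G.restState s) / X T
          - movesCard s * Real.exp (-(T * (G.potential s₀ - G.potential s)))) atTop (𝓝 0) := by
        refine squeeze_zero_norm' (hev.mono fun T hT => ?_)
          (by simpa only [mul_zero] using hη0.const_mul (G.profileCard ^ 3 * G.gapConstant))
        exact (hX T hT).2.1 s
      have h2 : Tendsto (fun T : ℝ => movesCard s *
          Real.exp (-(T * (G.potential s₀ - G.potential s)))) atTop
          (𝓝 (limitWeight (G.restState s))) := by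
        rcases (hs₀ s).eq_or_lt with heq | hlt
        · have hmax : IsMaximizer G.potential s := fun t => heq ▸ hs₀ t
          have : limitWeight (G.restState s) = movesCard s := if_pos ⟨s, rfl, hmax⟩
          rw [this, heq]
          simp
        · have : limitWeight (G.restState s) = 0 := by
            refine if_neg ?_
            rintro ⟨s', hs', hmax⟩
            have h3 : s = s' := congrArg (fun z => z.1.1) hs'
            subst h3
            exact (hmax s₀).not_gt hlt
          rw [this]
          simpa using (tendsto_exp_mul_neg (sub_pos.2 hlt)).const_mul (movesCard s)
      simpa using h1.add h2
    · push Not at hz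
      have : limitWeight z = 0 := by
        refine if_neg ?_
        rintro ⟨s', hs', -⟩
        exact hz s' hs'
      rw [this]
      refine squeeze_zero_norm' (hev.mono fun T hT => ?_)
        (by simpa only [mul_zero] using hη0.const_mul (G.stateCard * G.profileCard))
      exact (hX T hT).2.2 z hz
  -- The unknown scale X cancels, since ν has total mass 1.
  refine ((hlim z).div (tendsto_finsetSum Finset.univ fun z _ => hlim z)
    (sum_limitWeight_pos G).ne').congr' (hev.mono fun T hT => ?_)
  have hX0 := (hX T hT).1
  change ν T z / X T / ∑ z, ν T z / X T = ν T z
  rw [← Finset.sum_div, (hν T hT.1).2.1]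
  field_simp

end Limit

/-! ### Convergence of SPBLLA -/

/-- SPBLLA converges if `m` exceeds twice the effect of the moves of the other UAVs on the utility
of a UAV. -/
lemma converges_of_crossBound_lt {m : ℝ} (hm : ∀ i, 2 * G.crossBound i < m)
    {φ : G.Profile → ℝ} (hφ : IsPotential G.utility φ) : G.Converges m φ := by
  obtain ⟨i₀, -, hi₀⟩ := Finset.exists_max_image Finset.univ G.crossBound Finset.univ_nonempty
  have hcross : ∀ i, G.crossBound i ≤ G.crossBound i₀ := fun i => hi₀ i (Finset.mem_univ i)
  have hΛ := G.crossBound_nonneg i₀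
  -- The slack in m > 2Λ is divided into 8 parts: 4 are spent on the penalties in two experiments,
  -- and 4 remain as the decay rate of the gaps.
  have hη : 0 < (m - 2 * G.crossBound i₀) / 8 := by linarith [hm i₀]
  have hm' : m = 2 * G.crossBound i₀ + 8 * ((m - 2 * G.crossBound i₀) / 8) := by ring
  have hm0 : 0 < m := by linarith [hm i₀]
  have hst : ∀ ε ∈ Set.Ioo (0 : ℝ) 1,
      ∃! ν : G.State → ℝ, IsStationaryDistribution (G.spbllaNoise m ε) ν := fun ε hε => by
    rw [spbllaNoise_eq_kernel]
    exact existsUnique_isStationaryDistribution (kernel_mem_rowStochastic hm0 (neg_log_pos hε))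
      (kernel_isIrreducible hm0 (neg_log_pos hε))
  have hlim : ∀ ν : ℝ → G.State → ℝ,
      (∀ ε ∈ Set.Ioo (0 : ℝ) 1, IsStationaryDistribution (G.spbllaNoise m ε) (ν ε)) → ∀ z,
      Tendsto (fun ε => ν ε z) (𝓝[>] 0)
        (𝓝 (limitWeight z / ∑ z : G.State, limitWeight z)) := by
    intro ν hν z
    have h1 : ∀ T > 0, IsStationaryDistribution (G.kernel m T) (ν (Real.exp (-T))) := by
      intro T hT
      have := hν (Real.exp (-T)) ⟨Real.exp_pos _, Real.exp_lt_one_iff.2 (by linarith)⟩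
      rwa [spbllaNoise_eq_kernel, Real.log_exp, neg_neg] at this
    refine ((tendsto_stationaryDistribution hΛ hη hm' hcross h1 z).comp tendsto_neg_log).congr' ?_
    filter_upwards [self_mem_nhdsWithin] with ε hε
    rw [Function.comp_apply, neg_neg, Real.exp_log hε]
  refine ⟨spbllaNoise_isRegularPerturbed hm0, hst,
    ⟨fun z => limitWeight z / ∑ z : G.State, limitWeight z, fun ν hν =>
      tendsto_pi_nhds.2 (hlim ν hν)⟩, fun z => ?_, fun s hs => isPSNE_of_isMaximizer hφ hs⟩
  have hpos : 0 < limitWeight z / ∑ z : G.State, limitWeight z ↔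
      ∃ s, z = G.restState s ∧ IsMaximizer φ s := by
    rw [div_pos_iff_of_pos_right (sum_limitWeight_pos G), limitWeight_pos_iff]
    simp only [G.isMaximizer_iff_potential hφ]
  rw [← hpos]
  constructor
  · rintro ⟨ν, hν, l, hl, ht⟩
    rwa [← tendsto_nhds_unique ht (hlim ν hν z)]
  · intro h
    -- A family of stationary distributions exists, and every such family has the same limit, so the
    -- existential in stochastic stability is harmless.
    choose! ν hν using fun ε hε => (hst ε hε).exists
    exact ⟨ν, hν, _, h, hlim ν hν z⟩

end UAVNetwork

end

theorem theorem5 (G : UAVNetwork) :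
    -- the game is a potential game
    (∃ φ : G.Profile → ℝ, IsPotential G.utility φ) ∧
    -- arbitrary, possibly altitude-dependent, air turbulence index
    (∀ s s' : G.Profile, (∀ j, s' j ∈ G.moves j (s j)) →
      ∀ i, |G.utility i s' - G.utility i s| ≤ G.deltaVar i) ∧
    (∀ m : ℝ, (∀ i, 2 * G.deltaVar i < m) →
      ∀ φ : G.Profile → ℝ, IsPotential G.utility φ → G.Converges m φ) ∧
    -- constant air turbulence index
    (∀ b : ℝ, 0 ≤ b → (∀ k, G.β k = b) →
      (1 / 2 ≤ b → ∀ s s' : G.Profile, (∀ j, s' j ∈ G.moves j (s j)) →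
        ∀ i, |G.utility i s' - G.utility i s| ≤ G.delta b i) ∧
      (∀ m : ℝ, (∀ i, 2 * G.delta b i < m) →
        ∀ φ : G.Profile → ℝ, IsPotential G.utility φ → G.Converges m φ)) := by
  refine ⟨⟨G.potential, G.isPotential_potential⟩,
    fun s s' h i => G.abs_utility_sub_le_deltaVar h i,
    fun m hm φ hφ => UAVNetwork.converges_of_crossBound_lt (fun i => ?_) hφ,
    fun b hb hβ => ⟨fun hb' s s' h i => G.abs_utility_sub_le_delta hβ hb' h i,
      fun m hm φ hφ => UAVNetwork.converges_of_crossBound_lt (fun i => ?_) hφ⟩⟩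
  · linarith [hm i, G.crossBound_le_deltaVar i]
  · linarith [hm i, G.crossBound_le_delta hb i]
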